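/- Let $I\subset\mathbb R$ be an open interval and let $J\subset\mathbb Z$ be a (finite or infinite) set of consecutive integers. A semi-discrete curvature line net is a sequence $(x_k)_{k\in J}$ of smooth regular curves $x_k:I\to\mathbb R^3$ such that, whenever $k,k+1\in J$, the curves $x_k$ and $x_{k+1}$ form a Ribaucour pair: for every $u\in I$, $x_k(u)\neq x_{k+1}(u)$ and there is a circle (or straight line) that is tangent to $x_k$ at $x_k(u)$ and to $x_{k+1}$ at $x_{k+1}(u)$. Any semi-discrete curvature line net can be smoothed by a sequence of channel surfaces, that is, it lies on a $C^1$-surface composed of channel surfaces that meet at the curves of the net and have the same tangent planes there. Precisely: there are a $C^1$-map $f:I\times\mathbb R\to\mathbb R^3$ and a continuous unit normal field $N:I\times\mathbb R\to S^2$ of it, $N\perp\partial_uf,\partial_vf$, such that (i) for all $k\in J$ and $u\in I$: $f(u,k)=x_k(u)$, $f$ is immersed at $(u,k)$, and $x_k$ is a curvature line of the surface, i.e. $u\mapsto N(u,k)$ is differentiable with $\partial_uN(u,k)\in\mathbb R\,x_k'(u)$; (ii) whenever $k,k+1\in J$, the strip $f|_{I\times[k,k+1]}$ is a piece of a channel surface: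 it is smooth, and there are a smooth $1$-parameter family of oriented spheres (or planes) $s(u)$ and a smooth $1$-parameter family of circles (or straight lines) $c(u)\subset s(u)$, $u\in I$, such that $v\mapsto f(u,v)$ maps $[k,k+1]$ injectively into $c(u)$, and the strip envelops the spheres $s(u)$ and is touched by them along the arcs $f(u,[k,k+1])$: each $f(u,v)$ is a point of the envelope of the family $s$, and $N(u,v)$ is the unit normal of $s(u)$ at $f(u,v)$; (iii) as is usual for channel surfaces, the strips may have singularities between the curves of the net, but every arc $f(u,[k,k+1])$ with $k,k+1\in J$ contains at most finitely many points at which $f$ is not immersed. -/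

import Mathlib

open scoped ContDiff

/-- Euclidean 3-space. -/
abbrev E3 : Type := EuclideanSpace ℝ (Fin 3)

/-- The vector space `ℝ^{4,1} = ⟨o⟩ ⊕ ℝ³ ⊕ ⟨q⟩`; the triple `(h, w, g)` stands for
`h o + w + g q`. (Only its topology and linear structure come from the product type, the scalar
product is `moebiusInner`.) -/
abbrev MoebiusSpace : Type := ℝ × E3 × ℝ

/-- The scalar product of signature `(4,1)`: Euclidean on `ℝ³`, with `o`, `q` isotropic,
orthogonal to `ℝ³`, and `(o, q) = -1`. -/
noncomputable def moebiusInner (a b : MoebiusSpace) : ℝ :=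
  inner ℝ a.2.1 b.2.1 - a.1 * b.2.2 - a.2.2 * b.1

/-- The Euclidean lift `p ↦ o + p + ½ (p, p) q` of a point into the light cone. -/
noncomputable def euclideanLift (p : E3) : MoebiusSpace := (1, p, ‖p‖ ^ 2 / 2)

/-- `s` is an oriented 2-sphere or plane, i.e. a point of the Lorentz sphere `S^{3,1}`.
The sphere with centre `m` and radius `r` is `(1/r) (o + m + ½ ((m,m) - r²) q)`, the plane through
`x` with unit normal `n` is `n + (n, x) q`. -/
def IsOrientedSphere (s : MoebiusSpace) : Prop := moebiusInner s s = 1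

/-- The point `p` lies on the sphere or plane `s`. -/
def OnSphere (s : MoebiusSpace) (p : E3) : Prop := moebiusInner (euclideanLift p) s = 0

/-- The unit normal, at a point `p` of it, of the oriented sphere or plane `s`: for
`s = (1/r) (o + m + ½ ((m,m) - r²) q)` this is `(m - p) / r`, for `s = n + (n, x) q` it is `n`. -/
def sphereNormal (s : MoebiusSpace) (p : E3) : E3 := s.2.1 - s.1 • p

/-- The pair `(s, a)` represents a circle (or a straight line), as the intersection of two spheres
(or planes) that intersect orthogonally. -/
structure IsCircle (s a : MoebiusSpace) : Prop where
  left : IsOrientedSphere s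
  right : IsOrientedSphere a
  orthogonal : moebiusInner s a = 0

/-- The point `p` lies on the circle `s ∩ a`. -/
def OnCircle (s a : MoebiusSpace) (p : E3) : Prop := OnSphere s p ∧ OnSphere a p

/-- The circle `s ∩ a` passes through `p`, and the vector `v` is tangent to it there. -/
def TangentToCircle (s a : MoebiusSpace) (p v : E3) : Prop :=
  OnCircle s a p ∧ inner ℝ v (sphereNormal s p) = 0 ∧ inner ℝ v (sphereNormal a p) = 0

/-- `x` and `y` form a Ribaucour pair of curves on `I`: corresponding points are distinct, and there
is a circle (or straight line) touching both curves at corresponding points. -/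
structure IsRibaucourPair (I : Set ℝ) (x y : ℝ → E3) : Prop where
  ne : ∀ u ∈ I, x u ≠ y u
  circle : ∀ u ∈ I, ∃ s a : MoebiusSpace, IsCircle s a ∧
    TangentToCircle s a (x u) (deriv x u) ∧ TangentToCircle s a (y u) (deriv y u)

/-- A semi-discrete curvature line net: a sequence of smooth regular curves on `I`, indexed by `J`,
in which subsequent curves form Ribaucour pairs. -/
structure IsSemiDiscreteCurvatureLineNet (I : Set ℝ) (J : Set ℤ) (x : ℤ → ℝ → E3) : Prop where
  smooth : ∀ k ∈ J, ContDiffOn ℝ ∞ (x k) I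
  regular : ∀ k ∈ J, ∀ u ∈ I, deriv (x k) u ≠ 0
  ribaucour : ∀ k ∈ J, k + 1 ∈ J → IsRibaucourPair I (x k) (x (k + 1))

/-- `f` is a `C¹` surface, parametrized by `I × ℝ` and possibly with singular points, that has
continuous tangent planes: they are given by the continuous unit normal field `N`. -/
structure IsC1SurfaceWithNormal (I : Set ℝ) (f N : ℝ × ℝ → E3) : Prop where
  contDiff : ContDiffOn ℝ 1 f (I ×ˢ Set.univ)
  continuous : ContinuousOn N (I ×ˢ Set.univ)
  norm_eq_one : ∀ p ∈ I ×ˢ (Set.univ : Set ℝ), ‖N p‖ = 1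
  orthogonal : ∀ p ∈ I ×ˢ (Set.univ : Set ℝ), ∀ w : ℝ × ℝ, inner ℝ (fderiv ℝ f p w) (N p) = 0

/-- The piece of the surface `f`, with unit normal field `N`, over `I × V` is (a piece of) a channel
surface: it is smooth, it is swept out by arcs `f (u, V)` of a smooth 1-parameter family of
circles `s u ∩ a u`, and it envelops the smooth 1-parameter family of spheres `s u`, which touch it
along these arcs. -/
def IsChannelSurface (I V : Set ℝ) (f N : ℝ × ℝ → E3) : Prop :=
  ContDiffOn ℝ ∞ f (I ×ˢ V) ∧
  ∃ s a : ℝ → MoebiusSpace,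
    ContDiffOn ℝ ∞ s I ∧ ContDiffOn ℝ ∞ a I ∧
    ∀ u ∈ I, IsCircle (s u) (a u) ∧
      Set.InjOn (fun v => f (u, v)) V ∧
      ∀ v ∈ V,
        OnCircle (s u) (a u) (f (u, v)) ∧
        -- `f (u, v)` is a point of the envelope of the spheres
        moebiusInner (euclideanLift (f (u, v))) (deriv s u) = 0 ∧
        -- the surface and the sphere `s u` have the same normal at `f (u, v)`
        N (u, v) = sphereNormal (s u) (f (u, v))

/-! Let `d = y - x` be the chord of a Ribaucour pair. Reflection in the bisector plane of the chord
maps the normal of every sphere through both points at `x` to its normal at `y`, so `y'` is a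
multiple `μ` of the mirror image of `x'`. Let `n` be a unit normal field along `x` with `n' = ρ x'`;
this is what makes `x` a curvature line. Its mirror image is `n - κ d` with `κ = 2 (n, d) / |d|²`,
and `κ' = 2 τ (ρ + κ)` with `τ = (x', d) / |d|²`, independently of `μ`. It follows that the mirror
image is again a parallel normal field (`isParallelNormalField_mirror`). Thus one parallel frame
along one curve determines frames along the whole net.

The sphere touching `x` with normal `n` and curvature `κ` passes through `y` and has the mirrored
normal there. By the same formula for `κ'`, it meets the derivative of its family in the sphere
through `x` and `y` that is orthogonal to `x'` (in all its points if `ρ + κ = 0`). The strip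
therefore consists of arcs of these circles, leaving `x` in the direction `B` orthogonal to `x'` and
`n`. An arc with initial velocity `B` and unit speed at its ends arrives with velocity `-mirror d
B`; taking this as the next `B` makes all first derivatives fit.

The arc could pass through infinity if `d` were parallel to `B`, that is, orthogonal to `x'` and
`n`. Wherever `d ⊥ x'`, the components of `d` in a parallel frame have derivative zero, so a Sard
argument (`volume_setOf_orthogonal`) excludes only a null set of constant rotations of the frame for
each pair. Countably many pairs leave an admissible choice.

Along an arc the strip can be singular only where a quadratic form in the two arc weights vanishes.
It is nonzero at the first curve, so there are finitely many zeros (`finite_not_injective`). Beyond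
the ends of the net, a ruled surface with rulings `B` continues the surface. -/

/-! ### Reflections, sphere normals and Ribaucour pairs -/

section Mirror

variable {V : Type*} [NormedAddCommGroup V] [InnerProductSpace ℝ V]

/-- The reflection in the hyperplane orthogonal to `d` (the identity for `d = 0`). -/
noncomputable def mirror (d v : V) : V := v - (2 * inner ℝ v d / ‖d‖ ^ 2) • d

theorem inner_mirror_right (d v : V) : inner ℝ (mirror d v) d = - inner ℝ v d := by
  by_cases hd : d = 0
  · simp [hd]
  have : ‖d‖ ≠ 0 := by simpa using hd
  simp only [mirror, inner_sub_left, inner_smul_left, real_inner_self_eq_norm_sq]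
  simp
  field_simp
  ring

theorem mirror_mirror (d v : V) : mirror d (mirror d v) = v := by
  conv_lhs => rw [mirror, inner_mirror_right, mirror, mul_neg, neg_div]
  module

theorem mirror_neg_left (d v : V) : mirror (-d) v = mirror d v := by
  simp [mirror, neg_div, sub_eq_add_neg]

theorem mirror_add (d v w : V) : mirror d (v + w) = mirror d v + mirror d w := by
  simp only [mirror, inner_add_left]
  module

theorem mirror_smul (d : V) (c : ℝ) (v : V) : mirror d (c • v) = c • mirror d v := by
  simp only [mirror, inner_smul_left, conj_trivial]
  module

theorem inner_mirror_mirror (d v w : V) :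
    inner ℝ (mirror d v) (mirror d w) = inner ℝ v w := by
  conv_lhs => enter [3]; rw [mirror]
  rw [inner_sub_right, inner_smul_right, inner_mirror_right, mirror, inner_sub_left,
    inner_smul_left, real_inner_comm w d]
  simp
  ring

theorem norm_mirror (d v : V) : ‖mirror d v‖ = ‖v‖ := by
  have h := inner_mirror_mirror d v v
  simp only [real_inner_self_eq_norm_sq] at h
  exact (sq_eq_sq₀ (norm_nonneg _) (norm_nonneg _)).1 h

/-- In dimension three, two nonzero orthogonal vectors have a one-dimensional complement. -/
theorem exists_eq_smul_of_orthogonal (hV : Module.finrank ℝ V = 3) {a b w z : V}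
    (ha : a ≠ 0) (hb : b ≠ 0) (hw : w ≠ 0) (hab : inner ℝ a b = 0)
    (hwa : inner ℝ w a = 0) (hwb : inner ℝ w b = 0) (hza : inner ℝ z a = 0)
    (hzb : inner ℝ z b = 0) : ∃ c : ℝ, z = c • w := by
  have : FiniteDimensional ℝ V := Module.finite_of_finrank_pos (by omega)
  refine ⟨inner ℝ z w / ‖w‖ ^ 2, ?_⟩
  by_contra hne
  set y := z - (inner ℝ z w / ‖w‖ ^ 2) • w with hy
  have hy0 : y ≠ 0 := fun h => hne (sub_eq_zero.1 h)
  have hwn : ‖w‖ ≠ 0 := by simpa using hw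
  have hyw : inner ℝ y w = 0 := by
    rw [hy, inner_sub_left, inner_smul_left, real_inner_self_eq_norm_sq]
    simp
    field_simp
    ring
  have hya : inner ℝ y a = 0 := by
    rw [hy, inner_sub_left, inner_smul_left, hza, hwa]; simp
  have hyb : inner ℝ y b = 0 := by
    rw [hy, inner_sub_left, inner_smul_left, hzb, hwb]; simp
  -- The part of `z` orthogonal to `w` would be a fourth nonzero, pairwise orthogonal vector in
  -- dimension three.
  have hli : LinearIndependent ℝ ![a, b, w, y] := by
    apply linearIndependent_of_ne_zero_of_inner_eq_zero (𝕜 := ℝ)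
    · intro i; fin_cases i <;> simpa
    · intro i j hij
      have hba := hab; have haw := hwa; have hbw := hwb
      have hay := hya; have hby := hyb; have hwy := hyw
      rw [real_inner_comm] at hba haw hbw hay hby hwy
      fin_cases i <;> fin_cases j <;> first | exact absurd rfl hij | simpa
  have := hli.fintype_card_le_finrank
  simp [hV] at this

end Mirror

theorem finrank_E3 : Module.finrank ℝ E3 = 3 := by simp [E3]

theorem onSphere_iff (s : MoebiusSpace) (p : E3) :
    OnSphere s p ↔ inner ℝ p s.2.1 = s.2.2 + ‖p‖ ^ 2 / 2 * s.1 := by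
  simp only [OnSphere, moebiusInner, euclideanLift]
  constructor <;> intro h <;> linarith

/-- Incidence eliminates the `q`-components, so the Lorentz product is the cosine of the
intersection angle at any common point. The two spheres of an `IsCircle` thus give orthonormal
normals. -/
theorem inner_sphereNormal {s a : MoebiusSpace} {p : E3} (hs : OnSphere s p) (ha : OnSphere a p) :
    inner ℝ (sphereNormal s p) (sphereNormal a p) = moebiusInner s a := by
  rw [onSphere_iff] at hs ha
  simp only [sphereNormal, moebiusInner, inner_sub_left, inner_sub_right, inner_smul_left,
    inner_smul_right, real_inner_self_eq_norm_sq, conj_trivial]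
  rw [real_inner_comm s.2.1 p] at *
  rw [ha, hs]
  ring

/-- The normals of a sphere at two of its points are mirror images. -/
theorem sphereNormal_eq_mirror {s : MoebiusSpace} {p q : E3} (hpq : p ≠ q)
    (hp : OnSphere s p) (hq : OnSphere s q) :
    sphereNormal s q = mirror (q - p) (sphereNormal s p) := by
  rw [onSphere_iff] at hp hq
  have hd : ‖q - p‖ ^ 2 ≠ 0 := by
    simpa [sub_eq_zero] using hpq.symm
  -- Subtracting the two incidence equations identifies the coefficient of the reflection with the
  -- curvature `s.1`.
  have h : 2 * inner ℝ (sphereNormal s p) (q - p) / ‖q - p‖ ^ 2 = s.1 := by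
    rw [div_eq_iff hd, norm_sub_sq_real]
    simp only [sphereNormal, inner_sub_left, inner_sub_right, inner_smul_left,
      real_inner_self_eq_norm_sq, conj_trivial]
    rw [real_inner_comm q s.2.1, real_inner_comm p s.2.1, hp, hq, real_inner_comm p q]
    ring
  rw [mirror, h]
  simp only [sphereNormal]
  module

theorem IsRibaucourPair.symm {I : Set ℝ} {x y : ℝ → E3} (h : IsRibaucourPair I x y) :
    IsRibaucourPair I y x :=
  ⟨fun u hu => (h.ne u hu).symm, fun u hu => by
    obtain ⟨s, a, hc, h1, h2⟩ := h.circle u hu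
    exact ⟨s, a, hc, h2, h1⟩⟩

/-- The tangents of a Ribaucour pair of curves are mirror images. -/
theorem IsRibaucourPair.exists_deriv_eq {I : Set ℝ} {x y : ℝ → E3} (h : IsRibaucourPair I x y)
    {u : ℝ} (hu : u ∈ I) (hx : deriv x u ≠ 0) :
    ∃ μ : ℝ, deriv y u = μ • mirror (y u - x u) (deriv x u) := by
  obtain ⟨s, a, hc, ⟨⟨hsx, hax⟩, h1, h2⟩, ⟨⟨hsy, hay⟩, h3, h4⟩⟩ := h.circle u hu
  have hne := h.ne u hu
  rw [sphereNormal_eq_mirror hne hsx hsy] at h3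
  rw [sphereNormal_eq_mirror hne hax hay] at h4
  -- Reflected back to `x u`, the tangent of `y` is orthogonal to both sphere normals there, just as
  -- the tangent of `x` is.
  rw [← inner_mirror_mirror (y u - x u), mirror_mirror] at h3 h4
  have hss : inner ℝ (sphereNormal s (x u)) (sphereNormal s (x u)) = 1 :=
    (inner_sphereNormal hsx hsx).trans hc.left
  have haa : inner ℝ (sphereNormal a (x u)) (sphereNormal a (x u)) = 1 :=
    (inner_sphereNormal hax hax).trans hc.right
  have hsa : inner ℝ (sphereNormal s (x u)) (sphereNormal a (x u)) = 0 :=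
    (inner_sphereNormal hsx hax).trans hc.orthogonal
  obtain ⟨c, hcc⟩ := exists_eq_smul_of_orthogonal finrank_E3
    (by rintro h0; simp [h0] at hss) (by rintro h0; simp [h0] at haa) hx hsa h1 h2 h3 h4
  refine ⟨c, ?_⟩
  rw [← mirror_smul, ← hcc, mirror_mirror]

/-! ### Parallel normal fields and their reflection -/

/-- `n` is a smooth normal field along the curve `x` that is parallel in the normal bundle. -/
structure IsParallelNormalField (I : Set ℝ) (x n : ℝ → E3) : Prop where
  contDiffOn : ContDiffOn ℝ ∞ n I
  orthogonal : ∀ u ∈ I, inner ℝ (n u) (deriv x u) = 0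
  hasDerivAt : ∀ u ∈ I, ∃ ρ : ℝ, HasDerivAt n (ρ • deriv x u) u

theorem IsParallelNormalField.smul_add_smul {I : Set ℝ} {x n m : ℝ → E3}
    (hn : IsParallelNormalField I x n) (hm : IsParallelNormalField I x m) (c e : ℝ) :
    IsParallelNormalField I x (fun u => c • n u + e • m u) where
  contDiffOn := (hn.contDiffOn.const_smul c).add (hm.contDiffOn.const_smul e)
  orthogonal u hu := by
    simp [inner_add_left, inner_smul_left, hn.orthogonal u hu, hm.orthogonal u hu]
  hasDerivAt u hu := by
    obtain ⟨ρ, hρ⟩ := hn.hasDerivAt u hu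
    obtain ⟨σ, hσ⟩ := hm.hasDerivAt u hu
    refine ⟨c * ρ + e * σ, ?_⟩
    refine ((hρ.const_smul c).add (hσ.const_smul e)).congr_deriv ?_
    module

theorem hasDerivAt_of_contDiffOn {V : Type*} [NormedAddCommGroup V] [NormedSpace ℝ V] {I : Set ℝ}
    (hI : IsOpen I) {x : ℝ → V}
    (hx : ContDiffOn ℝ ∞ x I) {u : ℝ} (hu : u ∈ I) : HasDerivAt x (deriv x u) u :=
  ((hx.differentiableOn (by simp)).differentiableAt (hI.mem_nhds hu)).hasDerivAt

/-- The curvature of the sphere that touches the first curve of a Ribaucour pair, with normal `n`,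
and passes through the corresponding point of the second curve. -/
noncomputable def chordCurvature (d n : E3) : ℝ := 2 * inner ℝ n d / ‖d‖ ^ 2

theorem mirror_eq_sub_chordCurvature_smul (d n : E3) :
    mirror d n = n - chordCurvature d n • d := rfl

theorem ContDiffOn.chordCurvature {I : Set ℝ} {d n : ℝ → E3}
    (hd : ContDiffOn ℝ ∞ d I) (hn : ContDiffOn ℝ ∞ n I) (h0 : ∀ u ∈ I, d u ≠ 0) :
    ContDiffOn ℝ ∞ (fun u => chordCurvature (d u) (n u)) I := by
  refine (contDiffOn_const.mul (hn.inner ℝ hd)).div (hd.norm_sq ℝ) fun u hu => ?_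
  simpa using h0 u hu

/-- The vector `d'` lies in the span of `x'` and `d`, and `n ⊥ x'`, so only `(n, d)` and `‖d‖ ^ 2`
survive and `μ` cancels. This formula yields both the parallelism of the mirrored field and the
envelope condition. -/
theorem hasDerivAt_chordCurvature {n d : ℝ → E3} {u ρ μ τ : ℝ} {x' : E3}
    (hn : HasDerivAt n (ρ • x') u) (hd : HasDerivAt d (μ • mirror (d u) x' - x') u)
    (h0 : d u ≠ 0) (hnx : inner ℝ (n u) x' = 0) (hτ : inner ℝ x' (d u) = τ * ‖d u‖ ^ 2) :
    HasDerivAt (fun t => chordCurvature (d t) (n t))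
      (2 * τ * (ρ + chordCurvature (d u) (n u))) u := by
  have hd0 : ‖d u‖ ≠ 0 := by simpa using h0
  have h := ((hn.inner ℝ hd).const_mul 2).div hd.norm_sq (by simpa using h0)
  refine h.congr_deriv ?_
  have hm : mirror (d u) x' = x' - (2 * τ) • d u := by
    rw [mirror, hτ]; congr 2; field_simp
  have e1 : inner ℝ (n u) (μ • mirror (d u) x' - x') = - (2 * μ * τ) * inner ℝ (n u) (d u) := by
    rw [hm]
    simp only [inner_sub_right, inner_smul_right, hnx]
    ring
  have e2 : inner ℝ (d u) (μ • mirror (d u) x' - x') = - ((μ + 1) * τ) * ‖d u‖ ^ 2 := by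
    rw [hm]
    simp only [inner_sub_right, inner_smul_right, real_inner_comm x' (d u), hτ,
      real_inner_self_eq_norm_sq]
    ring
  simp only [chordCurvature]
  rw [e1, e2, inner_smul_left, hτ]
  simp only [conj_trivial]
  field_simp
  ring

/-- The data of a Ribaucour pair of smooth regular curves. -/
structure IsSmoothRibaucourPair (I : Set ℝ) (x y : ℝ → E3) : Prop where
  left : ContDiffOn ℝ ∞ x I
  right : ContDiffOn ℝ ∞ y I
  left_ne : ∀ u ∈ I, deriv x u ≠ 0
  right_ne : ∀ u ∈ I, deriv y u ≠ 0
  pair : IsRibaucourPair I x y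

namespace IsSmoothRibaucourPair

variable {I : Set ℝ} {x y n : ℝ → E3}

theorem symm (h : IsSmoothRibaucourPair I x y) : IsSmoothRibaucourPair I y x :=
  ⟨h.right, h.left, h.right_ne, h.left_ne, h.pair.symm⟩

theorem sub_ne_zero (h : IsSmoothRibaucourPair I x y) {u : ℝ} (hu : u ∈ I) : y u - x u ≠ 0 :=
  _root_.sub_ne_zero.2 (h.pair.ne u hu).symm

theorem contDiffOn_sub (h : IsSmoothRibaucourPair I x y) :
    ContDiffOn ℝ ∞ (fun u => y u - x u) I := h.right.sub h.left

theorem exists_deriv_eq (h : IsSmoothRibaucourPair I x y) {u : ℝ} (hu : u ∈ I) :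
    ∃ μ : ℝ, μ ≠ 0 ∧ deriv y u = μ • mirror (y u - x u) (deriv x u) := by
  obtain ⟨μ, hμ⟩ := h.pair.exists_deriv_eq hu (h.left_ne u hu)
  refine ⟨μ, ?_, hμ⟩
  rintro rfl
  exact h.right_ne u hu (by simpa using hμ)

theorem hasDerivAt_sub (hI : IsOpen I) (h : IsSmoothRibaucourPair I x y) {u : ℝ} (hu : u ∈ I) :
    HasDerivAt (fun u => y u - x u) (deriv y u - deriv x u) u :=
  (hasDerivAt_of_contDiffOn hI h.right hu).sub (hasDerivAt_of_contDiffOn hI h.left hu)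

theorem hasDerivAt_chordCurvature (hI : IsOpen I) (h : IsSmoothRibaucourPair I x y) {u ρ : ℝ}
    (hu : u ∈ I) (hn : HasDerivAt n (ρ • deriv x u) u) (hnx : inner ℝ (n u) (deriv x u) = 0) :
    HasDerivAt (fun t => chordCurvature (y t - x t) (n t))
      (2 * (inner ℝ (deriv x u) (y u - x u) / ‖y u - x u‖ ^ 2) *
        (ρ + chordCurvature (y u - x u) (n u))) u := by
  obtain ⟨μ, -, hμ⟩ := h.exists_deriv_eq hu
  have hd := h.hasDerivAt_sub hI hu
  rw [hμ] at hd
  have : ‖y u - x u‖ ^ 2 ≠ 0 := by simpa using h.sub_ne_zero hu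
  exact _root_.hasDerivAt_chordCurvature (d := fun t => y t - x t) hn hd (h.sub_ne_zero hu) hnx
    (div_mul_cancel₀ _ this).symm

/-- Reflection in the bisector planes maps parallel normal fields of one curve of a
Ribaucour pair to parallel normal fields of the other curve. -/
theorem isParallelNormalField_mirror (hI : IsOpen I) (h : IsSmoothRibaucourPair I x y)
    (hn : IsParallelNormalField I x n) :
    IsParallelNormalField I y (fun u => mirror (y u - x u) (n u)) where
  contDiffOn := hn.contDiffOn.sub
    ((h.contDiffOn_sub.chordCurvature hn.contDiffOn fun u hu => h.sub_ne_zero hu).smul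
      h.contDiffOn_sub)
  orthogonal u hu := by
    obtain ⟨μ, -, hμ⟩ := h.exists_deriv_eq hu
    rw [hμ, inner_smul_right, inner_mirror_mirror, hn.orthogonal u hu, mul_zero]
  hasDerivAt u hu := by
    obtain ⟨μ, hμ0, hμ⟩ := h.exists_deriv_eq hu
    obtain ⟨ρ, hρ⟩ := hn.hasDerivAt u hu
    have hl := h.hasDerivAt_chordCurvature hI hu hρ (hn.orthogonal u hu)
    -- With `κ` the chord curvature, `(n - κ d)' = ρ x' - 2τ(ρ + κ) d - κ (y' - x') = (ρ + κ)(x' -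
    -- 2τ d) - κ y'`, and `x' - 2τ d` is the mirror image `μ⁻¹ y'` of `x'`.
    refine ⟨(ρ + chordCurvature (y u - x u) (n u)) / μ - chordCurvature (y u - x u) (n u), ?_⟩
    refine (hρ.sub (hl.smul (h.hasDerivAt_sub hI hu))).congr_deriv ?_
    have : mirror (y u - x u) (deriv x u) = μ⁻¹ • deriv y u := by
      rw [hμ, smul_smul, inv_mul_cancel₀ hμ0, one_smul]
    rw [mirror, sub_eq_iff_eq_add] at this
    have e : deriv x u = μ⁻¹ • deriv y u +
      (2 * (inner ℝ (deriv x u) (y u - x u) / ‖y u - x u‖ ^ 2)) • (y u - x u) := by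
      rw [← mul_div_assoc]; exact this
    generalize (inner ℝ (deriv x u) (y u - x u) / ‖y u - x u‖ ^ 2) = τ at *
    rw [e]
    module

end IsSmoothRibaucourPair

/-! ### Existence of parallel frames -/

/-- The cross product of `ℝ³`. -/
noncomputable def cross (a b : E3) : E3 :=
  !₂[a 1 * b 2 - a 2 * b 1, a 2 * b 0 - a 0 * b 2, a 0 * b 1 - a 1 * b 0]

theorem inner_cross_left (a b : E3) : inner ℝ (cross a b) a = 0 := by
  simp [cross, PiLp.inner_apply, Fin.sum_univ_three]
  ring

theorem inner_cross_right (a b : E3) : inner ℝ (cross a b) b = 0 := by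
  simp [cross, PiLp.inner_apply, Fin.sum_univ_three]
  ring

theorem norm_cross_sq (a b : E3) :
    ‖cross a b‖ ^ 2 = ‖a‖ ^ 2 * ‖b‖ ^ 2 - inner ℝ a b ^ 2 := by
  simp [cross, PiLp.inner_apply, Fin.sum_univ_three, EuclideanSpace.real_norm_sq_eq]
  ring

theorem ContDiffOn.cross {I : Set ℝ} {a b : ℝ → E3} (ha : ContDiffOn ℝ ∞ a I)
    (hb : ContDiffOn ℝ ∞ b I) : ContDiffOn ℝ ∞ (fun u => cross (a u) (b u)) I := by
  rw [contDiffOn_euclidean] at ha hb ⊢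
  intro i
  fin_cases i
  · exact ((ha 1).mul (hb 2)).sub ((ha 2).mul (hb 1))
  · exact ((ha 2).mul (hb 0)).sub ((ha 0).mul (hb 2))
  · exact ((ha 0).mul (hb 1)).sub ((ha 1).mul (hb 0))

theorem cross_ne_zero {a e : E3} (ha : a ≠ 0) (h : ∀ c : ℝ, e ≠ c • a) : cross a e ≠ 0 := by
  intro h0
  have h1 := norm_cross_sq a e
  have ha' : ‖a‖ ≠ 0 := by simpa using ha
  refine h (inner ℝ a e / ‖a‖ ^ 2) (sub_eq_zero.1 (norm_eq_zero.1 (sq_eq_zero_iff.1 ?_)))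
  rw [norm_sub_sq_real, inner_smul_right, norm_smul, real_inner_comm, mul_pow, Real.norm_eq_abs,
    sq_abs]
  rw [h0] at h1
  field_simp
  simp at h1
  rw [real_inner_comm] at h1
  linear_combination -h1

/-- Some constant direction is never tangent to a given curve. -/
theorem exists_forall_ne_smul {I : Set ℝ} (hI : I.OrdConnected) {v : ℝ → E3}
    (hv : ContDiffOn ℝ ∞ v I) : ∃ e : E3, ∀ u ∈ I, ∀ c : ℝ, e ≠ c • v u := by
  have hc : ContDiffOn ℝ 1 (fun p : ℝ × ℝ => p.2 • v p.1) (I ×ˢ Set.univ) :=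
    contDiff_snd.contDiffOn.smul
      ((hv.of_le (by norm_cast)).comp contDiff_fst.contDiffOn fun p hp => hp.1)
  -- The multiples of all vectors `v u` form a `C¹` image of a set of dimension at most two, which
  -- cannot fill `ℝ³`.
  have hd := hc.dense_compl_image_of_dimH_lt_finrank
    ((convex_iff_ordConnected.2 hI).prod convex_univ) subset_rfl (by
      calc dimH (I ×ˢ (Set.univ : Set ℝ)) ≤ dimH (Set.univ : Set (ℝ × ℝ)) :=
            dimH_mono (Set.subset_univ _)
        _ < _ := by
            rw [Real.dimH_univ_eq_finrank, finrank_E3]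
            simp
            norm_num)
  obtain ⟨e, he⟩ := hd.nonempty
  exact ⟨e, fun u hu c hec => he ⟨(u, c), ⟨hu, trivial⟩, hec.symm⟩⟩

theorem ContDiffOn.normalize {I : Set ℝ} {c : ℝ → E3} (hc : ContDiffOn ℝ ∞ c I)
    (h0 : ∀ u ∈ I, c u ≠ 0) : ContDiffOn ℝ ∞ (fun u => ‖c u‖⁻¹ • c u) I :=
  ((hc.norm ℝ h0).inv fun u hu => by simpa using h0 u hu).smul hc

/-- A constant direction `e` that is never parallel to `v` makes `v × e` and `(v × e) × v` nowhere
zero. Unlike for the Frenet frame, no condition on the curvature is needed. -/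
theorem exists_normal_frame {I : Set ℝ} (hI : I.OrdConnected) {v : ℝ → E3}
    (hv : ContDiffOn ℝ ∞ v I) (h0 : ∀ u ∈ I, v u ≠ 0) :
    ∃ n b : ℝ → E3, ContDiffOn ℝ ∞ n I ∧ ContDiffOn ℝ ∞ b I ∧
      ∀ u ∈ I, ‖n u‖ = 1 ∧ ‖b u‖ = 1 ∧ inner ℝ (n u) (b u) = 0 ∧
        inner ℝ (n u) (v u) = 0 ∧ inner ℝ (b u) (v u) = 0 := by
  obtain ⟨e, he⟩ := exists_forall_ne_smul hI hv
  have hc0 : ∀ u ∈ I, cross (v u) e ≠ 0 := fun u hu => cross_ne_zero (h0 u hu) (he u hu)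
  have hc : ContDiffOn ℝ ∞ (fun u => cross (v u) e) I := hv.cross contDiffOn_const
  have hbv : ∀ u, inner ℝ (cross (v u) e) (v u) = 0 := fun u => inner_cross_left _ _
  have hm0 : ∀ u ∈ I, cross (cross (v u) e) (v u) ≠ 0 := by
    intro u hu hz
    have h1 := norm_cross_sq (cross (v u) e) (v u)
    rw [hbv, hz] at h1
    have := hc0 u hu
    have := h0 u hu
    simp_all
  refine ⟨_, _, (hc.cross hv).normalize hm0, hc.normalize hc0, fun u hu => ⟨?_, ?_, ?_, ?_, ?_⟩⟩
  · exact norm_smul_inv_norm (𝕜 := ℝ) (hm0 u hu)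
  · exact norm_smul_inv_norm (𝕜 := ℝ) (hc0 u hu)
  · simp [inner_smul_left, inner_smul_right, inner_cross_left]
  · simp [inner_smul_left, inner_cross_right]
  · simp [inner_smul_left, inner_cross_left]

theorem exists_primitive {I : Set ℝ} (hI : IsOpen I) (hI' : I.OrdConnected) {w : ℝ → ℝ}
    (hw : ContDiffOn ℝ ∞ w I) :
    ∃ θ : ℝ → ℝ, ContDiffOn ℝ ∞ θ I ∧ ∀ u ∈ I, HasDerivAt θ (w u) u := by
  rcases I.eq_empty_or_nonempty with rfl | ⟨a, ha⟩
  · exact ⟨0, contDiffOn_empty, fun u hu => absurd hu (Set.notMem_empty u)⟩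
  have hd : ∀ u ∈ I, HasDerivAt (fun u => ∫ t in a..u, w t) (w u) u := by
    intro u hu
    refine intervalIntegral.integral_hasDerivAt_right
      ((hw.continuousOn.mono (hI'.uIcc_subset ha hu)).intervalIntegrable)
      (hw.continuousOn.stronglyMeasurableAtFilter hI u hu)
      (hw.continuousOn.continuousAt (hI.mem_nhds hu))
  refine ⟨_, ?_, hd⟩
  rw [contDiffOn_infty_iff_deriv_of_isOpen hI]
  exact ⟨fun u hu => (hd u hu).differentiableAt.differentiableWithinAt,
    hw.congr fun u hu => (hd u hu).deriv⟩

/-- The derivative of the rotated field has normal components proportional to `θ' + (n', b)`, which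
the choice of `θ'` annihilates; what remains is tangent to the curve. -/
theorem isParallelNormalField_rotate {I : Set ℝ} (hI : IsOpen I) {x n b : ℝ → E3} {θ : ℝ → ℝ}
    (hx : ∀ u ∈ I, deriv x u ≠ 0) (hn : ContDiffOn ℝ ∞ n I) (hb : ContDiffOn ℝ ∞ b I)
    (hnb : ∀ u ∈ I, ‖n u‖ = 1 ∧ ‖b u‖ = 1 ∧ inner ℝ (n u) (b u) = 0 ∧
        inner ℝ (n u) (deriv x u) = 0 ∧ inner ℝ (b u) (deriv x u) = 0)
    (hθ : ContDiffOn ℝ ∞ θ I)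
    (hθ' : ∀ u ∈ I, HasDerivAt θ (-inner ℝ (deriv n u) (b u)) u) :
    IsParallelNormalField I x (fun u => Real.cos (θ u) • n u + Real.sin (θ u) • b u) where
  contDiffOn := (hθ.cos.smul hn).add (hθ.sin.smul hb)
  orthogonal u hu := by
    obtain ⟨-, -, -, h1, h2⟩ := hnb u hu
    simp [inner_add_left, inner_smul_left, h1, h2]
  hasDerivAt u hu := by
    obtain ⟨hn1, hb1, h0, h1, h2⟩ := hnb u hu
    have dn := hasDerivAt_of_contDiffOn hI hn hu
    have db := hasDerivAt_of_contDiffOn hI hb hu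
    have hd := (((hθ' u hu).cos).smul dn).add (((hθ' u hu).sin).smul db)
    have key : ∀ {f g : ℝ → E3} {f' g' : E3} {c : ℝ}, HasDerivAt f f' u → HasDerivAt g g' u →
        (∀ t ∈ I, inner ℝ (f t) (g t) = c) → inner ℝ (f u) g' + inner ℝ f' (g u) = 0 := by
      intro f g f' g' c hf hg hc
      have h3 := hf.inner ℝ hg
      have h4 : HasDerivAt (fun t => inner ℝ (f t) (g t)) 0 u :=
        (hasDerivAt_const u c).congr_of_eventuallyEq
          (Filter.eventuallyEq_of_mem (hI.mem_nhds hu) hc)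
      exact h3.unique h4
    have k1 := key dn dn (c := 1) fun t ht => by simp [(hnb t ht).1]
    have k2 := key db db (c := 1) fun t ht => by simp [(hnb t ht).2.1]
    have k3 := key dn db (c := 0) fun t ht => (hnb t ht).2.2.1
    rw [real_inner_comm] at k1 k2
    have hna : n u ≠ 0 := by rintro hz; simp [hz] at hn1
    have hba : b u ≠ 0 := by rintro hz; simp [hz] at hb1
    rw [real_inner_comm] at h1 h2
    have hbn : inner ℝ (b u) (n u) = 0 := by rw [real_inner_comm]; exact h0
    rw [real_inner_comm] at k3
    obtain ⟨ρ, hρ⟩ := exists_eq_smul_of_orthogonal finrank_E3 hna hba (hx u hu) h0 h1 h2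
      (z := Real.cos (θ u) • deriv n u +
        (-Real.sin (θ u) * -inner ℝ (deriv n u) (b u)) • n u + (Real.sin (θ u) • deriv b u +
        (Real.cos (θ u) * -inner ℝ (deriv n u) (b u)) • b u)) (by
        simp only [inner_add_left, inner_smul_left, hbn, real_inner_self_eq_norm_sq, hn1,
          conj_trivial, neg_mul]
        linear_combination Real.cos (θ u) * k1 / 2 + Real.sin (θ u) * k3) (by
        simp only [inner_add_left, inner_smul_left, h0, real_inner_self_eq_norm_sq, hb1,
          conj_trivial, neg_mul]
        linear_combination Real.sin (θ u) * k2 / 2)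
    exact ⟨ρ, hρ ▸ hd⟩

/-- An orthonormal frame of parallel normal fields along `x`. -/
structure IsParallelFrame (I : Set ℝ) (x n b : ℝ → E3) : Prop where
  left : IsParallelNormalField I x n
  right : IsParallelNormalField I x b
  norm_left : ∀ u ∈ I, ‖n u‖ = 1
  norm_right : ∀ u ∈ I, ‖b u‖ = 1
  inner_eq_zero : ∀ u ∈ I, inner ℝ (n u) (b u) = 0

theorem exists_isParallelFrame {I : Set ℝ} (hI : IsOpen I) (hI' : I.OrdConnected) {x : ℝ → E3}
    (hx : ContDiffOn ℝ ∞ x I) (hx0 : ∀ u ∈ I, deriv x u ≠ 0) :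
    ∃ n b : ℝ → E3, IsParallelFrame I x n b := by
  obtain ⟨n, b, hn, hb, hnb⟩ := exists_normal_frame hI' (hx.deriv_of_isOpen hI (by simp)) hx0
  obtain ⟨θ, hθ, hθ'⟩ := exists_primitive hI hI'
    (((hn.deriv_of_isOpen hI (m := ∞) (by simp)).inner ℝ hb).neg)
  have h1 := isParallelNormalField_rotate hI hx0 hn hb hnb hθ hθ'
  -- A constant added to the angle preserves parallelism; a quarter turn gives the orthogonal
  -- companion.
  have h2 := isParallelNormalField_rotate (θ := fun u => θ u + Real.pi / 2) hI hx0 hn hb hnb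
    (hθ.add contDiffOn_const) (fun u hu => (hθ' u hu).add_const _)
  refine ⟨_, _, h1, h2, fun u hu => ?_, fun u hu => ?_, fun u hu => ?_⟩ <;>
    obtain ⟨hn1, hb1, h0, -, -⟩ := hnb u hu <;>
    have hbn : inner ℝ (b u) (n u) = 0 := (real_inner_comm _ _).trans h0
  · rw [← sq_eq_sq₀ (norm_nonneg _) zero_le_one, norm_add_sq_real]
    simp [norm_smul, inner_smul_left, inner_smul_right, hn1, hb1, h0]
  · rw [← sq_eq_sq₀ (norm_nonneg _) zero_le_one, norm_add_sq_real]
    simp [norm_smul, inner_smul_left, inner_smul_right, hn1, hb1, h0, Real.sin_add_pi_div_two,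
      Real.cos_add_pi_div_two]
  · simp [inner_add_left, inner_add_right, inner_smul_left, inner_smul_right, hn1, hb1, h0, hbn,
      Real.sin_add_pi_div_two, Real.cos_add_pi_div_two]
    ring

theorem IsParallelFrame.mirror {I : Set ℝ} (hI : IsOpen I) {x y n b : ℝ → E3}
    (h : IsSmoothRibaucourPair I x y) (hf : IsParallelFrame I x n b) :
    IsParallelFrame I y (fun u => mirror (y u - x u) (n u)) (fun u => mirror (y u - x u) (b u)) where
  left := h.isParallelNormalField_mirror hI hf.left
  right := h.isParallelNormalField_mirror hI hf.right
  norm_left u hu := by rw [norm_mirror, hf.norm_left u hu]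
  norm_right u hu := by rw [norm_mirror, hf.norm_right u hu]
  inner_eq_zero u hu := by rw [inner_mirror_mirror, hf.inner_eq_zero u hu]

/-! ### A Sard argument for the position of the chord -/

/-- The chord of a Ribaucour pair has stationary direction relative to a parallel frame wherever it
is orthogonal to the curve. So, for almost all parallel normal fields, it is nowhere orthogonal to
both the curve and the normal field. -/
theorem IsSmoothRibaucourPair.volume_setOf_orthogonal {I : Set ℝ} (hI : IsOpen I)
    {x y n b : ℝ → E3} (h : IsSmoothRibaucourPair I x y) (hf : IsParallelFrame I x n b) :
    MeasureTheory.volume {m : ℝ | ∃ u ∈ I, inner ℝ (y u - x u) (deriv x u) = 0 ∧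
      inner ℝ (y u - x u) (n u + m • b u) = 0} = 0 := by
  set S : Set ℝ := {u | u ∈ I ∧ inner ℝ (y u - x u) (deriv x u) = 0 ∧
    inner ℝ (y u - x u) (b u) ≠ 0} with hS
  -- `g u` is the only `m` for which the chord at `u` is orthogonal to `n u + m • b u`.
  set g : ℝ → ℝ := fun u => - (inner ℝ (y u - x u) (n u) / inner ℝ (y u - x u) (b u)) with hg
  have hder : ∀ u ∈ S, HasFDerivWithinAt g (0 : ℝ →L[ℝ] ℝ) S u := by
    rintro u ⟨hu, hux, hub⟩
    obtain ⟨μ, -, hμ⟩ := h.exists_deriv_eq hu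
    -- A chord orthogonal to `x'` has a bisector plane parallel to `x'`, so `y'` and hence the
    -- derivative of the chord are multiples of `x'`.
    have hm : mirror (y u - x u) (deriv x u) = deriv x u := by
      rw [_root_.mirror, real_inner_comm, hux]; simp
    have key : ∀ {f : ℝ → E3}, IsParallelNormalField I x f →
        HasDerivAt (fun t => inner ℝ (y t - x t) (f t)) 0 u := by
      intro f hf
      obtain ⟨ρ, hρ⟩ := hf.hasDerivAt u hu
      refine ((h.hasDerivAt_sub hI hu).inner ℝ hρ).congr_deriv ?_
      rw [hμ, hm, inner_smul_right, hux, inner_sub_left, inner_smul_left, real_inner_comm,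
        hf.orthogonal u hu]
      simp
    have := ((key hf.left).div (key hf.right) hub).neg
    have h0 : HasDerivAt g 0 u := this.congr_deriv (by simp)
    have := h0.hasFDerivAt.hasFDerivWithinAt (s := S)
    rwa [ContinuousLinearMap.toSpanSingleton_zero] at this
  have hnull : MeasureTheory.volume (g '' S) = 0 := by
    refine MeasureTheory.addHaar_image_eq_zero_of_det_fderivWithin_eq_zero _ hder fun u hu => ?_
    rw [ContinuousLinearMap.det]
    simp
  refine MeasureTheory.measure_mono_null ?_ hnull
  rintro m ⟨u, hu, hux, hum⟩
  rw [inner_add_right, inner_smul_right] at hum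
  -- Otherwise the chord would be orthogonal to `n`, `b` and `x'`, hence zero.
  have hub : inner ℝ (y u - x u) (b u) ≠ 0 := by
    intro hb0
    rw [hb0, mul_zero, add_zero] at hum
    have hn0 : n u ≠ 0 := by intro hz; simpa [hz] using hf.norm_left u hu
    have hb0' : b u ≠ 0 := by intro hz; simpa [hz] using hf.norm_right u hu
    obtain ⟨c, hc⟩ := exists_eq_smul_of_orthogonal finrank_E3 hn0 hb0' (h.left_ne u hu)
      (hf.inner_eq_zero u hu) ((real_inner_comm _ _).trans (hf.left.orthogonal u hu))
      ((real_inner_comm _ _).trans (hf.right.orthogonal u hu)) hum hb0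
    apply h.sub_ne_zero hu
    rw [← inner_self_eq_zero (𝕜 := ℝ)]
    conv_lhs => enter [3]; rw [hc]
    rw [inner_smul_right, hux, mul_zero]
  refine ⟨u, ⟨hu, hux, hub⟩, ?_⟩
  simp only [hg]
  field_simp
  linarith

/-! ### Circular arcs with unit speed at both ends -/

/-- The weights of the end points in the rational parametrization of a circular arc with chord
length `l`; they are chosen such that the arc has unit speed at both ends. -/
noncomputable def arcWeight (l t : ℝ) : ℝ := t * (l * t + (1 - t))

theorem arcWeight_zero (l : ℝ) : arcWeight l 0 = 0 := by simp [arcWeight]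

theorem arcWeight_one (l : ℝ) : arcWeight l 1 = l := by simp [arcWeight]

theorem arcWeight_pos {l t : ℝ} (hl : 0 < l) (h0 : 0 < t) (h1 : t ≤ 1) : 0 < arcWeight l t := by
  have : 0 < l * t := mul_pos hl h0
  exact mul_pos h0 (by linarith)

theorem hasDerivAt_arcWeight (l t : ℝ) : HasDerivAt (arcWeight l) (2 * (l - 1) * t + 1) t := by
  have h := (hasDerivAt_id t).mul
    (((hasDerivAt_id t).const_mul l).add ((hasDerivAt_id t).const_sub 1))
  refine h.congr_deriv ?_
  simp
  ring

theorem hasDerivAt_arcWeight_one_sub (l t : ℝ) :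
    HasDerivAt (fun t => arcWeight l (1 - t)) (-(2 * (l - 1) * (1 - t) + 1)) t := by
  have h := (hasDerivAt_arcWeight l (1 - t)).comp t ((hasDerivAt_id t).const_sub 1)
  exact h.congr_deriv (by simp)

/-- The ratio of the weights at `t` and `1 - t` is the position on the arc; cross-multiplication
includes the end points. The difference of the two sides contains the factor `s - t`, and the other
factor is positive because `s(1-t) + t(1-s)` and `st + (1-s)(1-t)` are nonnegative with sum one. -/
theorem arcWeight_ratio_injective {l s t : ℝ} (hl : 0 < l) (hs : s ∈ Set.Icc (0 : ℝ) 1)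
    (ht : t ∈ Set.Icc (0 : ℝ) 1)
    (h : arcWeight l s * arcWeight l (1 - t) = arcWeight l t * arcWeight l (1 - s)) : s = t := by
  have e : arcWeight l s * arcWeight l (1 - t) - arcWeight l t * arcWeight l (1 - s) =
      (s - t) * (l ^ 2 * (s * (1 - t) + t * (1 - s)) + l * (s * t + (1 - s) * (1 - t))) := by
    simp only [arcWeight]
    ring
  rw [h, sub_self, eq_comm, mul_eq_zero] at e
  obtain ⟨hs0, hs1⟩ := hs
  obtain ⟨ht0, ht1⟩ := ht
  rcases e with e | e
  · linarith
  · exfalso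
    have a1 : 0 ≤ s * (1 - t) + t * (1 - s) :=
      add_nonneg (mul_nonneg hs0 (by linarith)) (mul_nonneg ht0 (by linarith))
    have a2 : 0 ≤ s * t + (1 - s) * (1 - t) :=
      add_nonneg (mul_nonneg hs0 ht0) (mul_nonneg (by linarith) (by linarith))
    have b1 := mul_nonneg (sq_nonneg l) a1
    have b2 := mul_nonneg hl.le a2
    have c1 : l ^ 2 * (s * (1 - t) + t * (1 - s)) = 0 := by linarith
    have c2 : l * (s * t + (1 - s) * (1 - t)) = 0 := by linarith
    rw [mul_eq_zero, or_iff_right (by positivity)] at c1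
    rw [mul_eq_zero, or_iff_right hl.ne'] at c2
    linarith

/-- The numerator of the derivative of the weight ratio, and a factor of `arcVelocity`. -/
theorem arcWeight_wronskian_pos {l t : ℝ} (hl : 0 < l) (ht : t ∈ Set.Icc (0 : ℝ) 1) :
    0 < (2 * (l - 1) * t + 1) * arcWeight l (1 - t) +
      arcWeight l t * (2 * (l - 1) * (1 - t) + 1) := by
  have e : (2 * (l - 1) * t + 1) * arcWeight l (1 - t) +
      arcWeight l t * (2 * (l - 1) * (1 - t) + 1) =
      l * (2 * l * (t * (1 - t)) + (t ^ 2 + (1 - t) ^ 2)) := by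
    simp only [arcWeight]
    ring
  rw [e]
  have : 0 ≤ t * (1 - t) := mul_nonneg ht.1 (by linarith [ht.2])
  have h2 : 0 < t ^ 2 + (1 - t) ^ 2 := by nlinarith [sq_nonneg (2 * t - 1)]
  positivity

section Arc

variable {V : Type*} [NormedAddCommGroup V] [InnerProductSpace ℝ V]

/-- The direction of the chord in the parametrization of a circular arc. -/
noncomputable def arcDirection (d b : V) (t : ℝ) : V :=
  arcWeight ‖d‖ t • d + (arcWeight ‖d‖ (1 - t) * ‖d‖) • b

/-- The circular arc that leaves the origin in direction `b` and ends in `d`, parametrized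
over `[0, 1]` and with unit speed at both ends. -/
noncomputable def arcChord (d b : V) (t : ℝ) : V :=
  (‖d‖ ^ 2 * arcWeight ‖d‖ t / ‖arcDirection d b t‖ ^ 2) • arcDirection d b t

/-- Inversion in the unit sphere about the origin maps the arc to the line through `d / ‖d‖ ^ 2`
with direction `b`, and `arcDirection` is a multiple of the inverted point (at `t = 0`, of the
direction `b`). It can vanish only if this line contains the origin, i.e. if `d` is parallel to `b`.
-/
theorem arcDirection_ne_zero {d b : V} (hd : d ≠ 0) (hb : b ≠ 0) (hdb : ∀ c : ℝ, d ≠ c • b) {t : ℝ}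
    (ht : t ∈ Set.Icc (0 : ℝ) 1) : arcDirection d b t ≠ 0 := by
  have hl : 0 < ‖d‖ := norm_pos_iff.2 hd
  intro h
  rw [arcDirection] at h
  rcases ht.1.eq_or_lt with rfl | h0
  · simp [arcWeight_zero, arcWeight_one, hd, hb] at h
  · have hA := arcWeight_pos hl h0 ht.2
    refine hdb (-(arcWeight ‖d‖ t)⁻¹ * (arcWeight ‖d‖ (1 - t) * ‖d‖)) ?_
    have h1 := congrArg (fun z => (arcWeight ‖d‖ t)⁻¹ • z) (eq_neg_of_add_eq_zero_left h)
    simp only [smul_smul, inv_mul_cancel₀ hA.ne', one_smul, smul_neg] at h1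
    refine h1.trans ?_
    module

theorem arcChord_zero (d b : V) : arcChord d b 0 = 0 := by
  simp [arcChord, arcWeight_zero]

theorem arcChord_one {d : V} (b : V) (hd : d ≠ 0) : arcChord d b 1 = d := by
  have hl : ‖d‖ ≠ 0 := by simpa using hd
  have : arcDirection d b 1 = ‖d‖ • d := by simp [arcDirection, arcWeight_one, arcWeight_zero]
  rw [arcChord, this, arcWeight_one, smul_smul, norm_smul, norm_norm]
  have : ‖d‖ ^ 2 * ‖d‖ / (‖d‖ * ‖d‖) ^ 2 * ‖d‖ = 1 := by field_simp
  rw [this, one_smul]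

theorem norm_arcChord_sq (d b : V) (t : ℝ) :
    ‖arcChord d b t‖ ^ 2 =
      ‖d‖ ^ 2 * arcWeight ‖d‖ t / ‖arcDirection d b t‖ ^ 2 * (‖d‖ ^ 2 * arcWeight ‖d‖ t) := by
  rw [arcChord, norm_smul, mul_pow, Real.norm_eq_abs, sq_abs]
  by_cases h : ‖arcDirection d b t‖ = 0
  · simp [h]
  · field_simp

/-- The arc lies on every sphere that contains its end points and is tangent to `b` at the origin. -/
theorem inner_arcChord {d b w : V} {σ : ℝ} (hd : inner ℝ w d = σ * ‖d‖ ^ 2)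
    (hb : inner ℝ w b = 0) (t : ℝ) :
    inner ℝ w (arcChord d b t) = σ * ‖arcChord d b t‖ ^ 2 := by
  rw [norm_arcChord_sq, arcChord, inner_smul_right, arcDirection, inner_add_right,
    inner_smul_right, inner_smul_right, hd, hb]
  ring

theorem arcChord_injOn {d b : V} (hd : d ≠ 0) (hb : b ≠ 0) (hdb : ∀ c : ℝ, d ≠ c • b) :
    Set.InjOn (arcChord d b) (Set.Icc 0 1) := by
  intro s hs t ht h
  have hl : 0 < ‖d‖ := norm_pos_iff.2 hd
  have hs0 := arcDirection_ne_zero hd hb hdb hs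
  have ht0 := arcDirection_ne_zero hd hb hdb ht
  have hne : ∀ {r}, r ∈ Set.Icc (0 : ℝ) 1 → arcChord d b r = 0 → r = 0 := by
    intro r hr hr0
    by_contra hne
    have h1 := arcWeight_pos hl (lt_of_le_of_ne hr.1 (Ne.symm hne)) hr.2
    have h2 := arcDirection_ne_zero hd hb hdb hr
    rw [arcChord, smul_eq_zero, or_iff_left h2] at hr0
    have : 0 < ‖arcDirection d b r‖ := norm_pos_iff.2 h2
    exact absurd hr0 (by positivity)
  by_cases hz : arcChord d b s = 0
  · rw [hne hs hz, hne ht (h ▸ hz)]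
  have hn := congrArg (fun z => ‖z‖ ^ 2) h
  simp only [norm_arcChord_sq] at hn
  have hz' : ‖arcChord d b s‖ ^ 2 ≠ 0 := by simpa using hz
  rw [norm_arcChord_sq] at hz'
  rw [arcChord, arcChord] at h
  set c := ‖d‖ ^ 2 * arcWeight ‖d‖ s / ‖arcDirection d b s‖ ^ 2
  set c' := ‖d‖ ^ 2 * arcWeight ‖d‖ t / ‖arcDirection d b t‖ ^ 2
  -- Equal points have equal norms, which by `norm_arcChord_sq` are these products up to the factor
  -- `‖d‖ ^ 2`. Cross-multiplying then cancels the `d`-components, and the `b`-component compares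
  -- the weight ratios.
  have hcA : c * arcWeight ‖d‖ s = c' * arcWeight ‖d‖ t := by
    have : ‖d‖ ^ 2 ≠ 0 := by positivity
    apply mul_left_cancel₀ this
    linarith
  have hc0 : c * arcWeight ‖d‖ s ≠ 0 := by
    intro h0
    apply hz'
    linear_combination ‖d‖ ^ 2 * h0
  have key : arcWeight ‖d‖ t • arcDirection d b s = arcWeight ‖d‖ s • arcDirection d b t := by
    apply smul_right_injective V hc0
    calc (c * arcWeight ‖d‖ s) • arcWeight ‖d‖ t • arcDirection d b s
        = (arcWeight ‖d‖ s * arcWeight ‖d‖ t) • c • arcDirection d b s := by module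
      _ = (c' * arcWeight ‖d‖ t) • arcWeight ‖d‖ s • arcDirection d b t := by rw [h]; module
      _ = _ := by rw [← hcA]
  have key2 : ((arcWeight ‖d‖ s * arcWeight ‖d‖ (1 - t) -
      arcWeight ‖d‖ t * arcWeight ‖d‖ (1 - s)) * ‖d‖) • b = 0 := by
    rw [← sub_eq_zero] at key
    rw [← neg_eq_zero, ← key, arcDirection, arcDirection]
    module
  rw [smul_eq_zero, or_iff_left hb, mul_eq_zero, or_iff_left hl.ne', sub_eq_zero] at key2
  exact arcWeight_ratio_injective hl hs ht key2

/-- The derivative of `arcChord`. -/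
noncomputable def arcVelocity (d b : V) (t : ℝ) : V :=
  (‖d‖ ^ 2 * ((2 * (‖d‖ - 1) * t + 1) * arcWeight ‖d‖ (1 - t) +
      arcWeight ‖d‖ t * (2 * (‖d‖ - 1) * (1 - t) + 1)) / ‖arcDirection d b t‖ ^ 4) •
    ((2 * inner ℝ (arcDirection d b t) (‖d‖ • b)) • arcDirection d b t -
      ‖arcDirection d b t‖ ^ 2 • ‖d‖ • b)

theorem hasDerivAt_arcChord {d b : V} (hb : ‖b‖ = 1) {t : ℝ} (h0 : arcDirection d b t ≠ 0) :
    HasDerivAt (arcChord d b) (arcVelocity d b t) t := by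
  set l := ‖d‖ with hl
  have hZ : HasDerivAt (arcDirection d b) ((2 * (l - 1) * t + 1) • d +
      (-(2 * (l - 1) * (1 - t) + 1) * l) • b) t :=
    ((hasDerivAt_arcWeight l t).smul_const d).add
      (((hasDerivAt_arcWeight_one_sub l t).mul_const l).smul_const b)
  have hZ0 : ‖arcDirection d b t‖ ^ 2 ≠ 0 := by simpa using h0
  have h := ((((hasDerivAt_arcWeight l t).const_mul (l ^ 2)).div hZ.norm_sq hZ0)).smul hZ
  refine h.congr_deriv ?_
  have hP : ‖arcDirection d b t‖ ^ 2 = arcWeight l t ^ 2 * l ^ 2 +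
      2 * arcWeight l t * arcWeight l (1 - t) * l * inner ℝ d b +
      arcWeight l (1 - t) ^ 2 * l ^ 2 := by
    rw [arcDirection, norm_add_sq_real, norm_smul, norm_smul, inner_smul_left, inner_smul_right,
      hb, mul_pow, mul_pow, Real.norm_eq_abs, Real.norm_eq_abs, sq_abs, sq_abs]
    simp only [conj_trivial, ← hl]
    ring
  have hZb : inner ℝ (arcDirection d b t) (l • b) =
      l * (arcWeight l t * inner ℝ d b + arcWeight l (1 - t) * l) := by
    rw [arcDirection, inner_smul_right, inner_add_left, inner_smul_left, inner_smul_left,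
      real_inner_self_eq_norm_sq, hb]
    simp [← hl]
  have hZZ : inner ℝ (arcDirection d b t) ((2 * (l - 1) * t + 1) • d +
      (-(2 * (l - 1) * (1 - t) + 1) * l) • b) =
      arcWeight l t * (2 * (l - 1) * t + 1) * l ^ 2 +
      (arcWeight l t * (-(2 * (l - 1) * (1 - t) + 1)) +
        (2 * (l - 1) * t + 1) * arcWeight l (1 - t)) * l * inner ℝ d b +
      arcWeight l (1 - t) * (-(2 * (l - 1) * (1 - t) + 1)) * l ^ 2 := by
    rw [arcDirection]
    simp only [inner_add_left, inner_add_right, inner_smul_left, inner_smul_right,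
      real_inner_self_eq_norm_sq, hb, conj_trivial, real_inner_comm d b, ← hl]
    ring
  rw [Pi.div_apply, arcVelocity, hZb, hZZ, show ‖arcDirection d b t‖ ^ 4 = (‖arcDirection d b t‖ ^ 2) ^ 2 by ring]
  rw [hP] at hZ0 ⊢
  simp only [arcDirection, ← hl]
  -- The identity is rational in the weights, their derivatives and `inner ℝ d b`; no relation
  -- between these is needed.
  generalize arcWeight l t = A at *
  generalize arcWeight l (1 - t) = C at *
  generalize 2 * (l - 1) * t + 1 = A' at *
  generalize 2 * (l - 1) * (1 - t) + 1 = C' at *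
  match_scalars
  · field_simp
    ring
  · field_simp
    ring

/-- Up to a nonzero factor, the velocity is the mirror image of `b` with respect to `arcDirection`:
the differential of the inversion applied to the direction of the line. -/
theorem arcVelocity_ne_zero {d b : V} (hd : d ≠ 0) (hb : b ≠ 0) (hdb : ∀ c : ℝ, d ≠ c • b) {t : ℝ}
    (ht : t ∈ Set.Icc (0 : ℝ) 1) : arcVelocity d b t ≠ 0 := by
  have h0 : 0 < ‖arcDirection d b t‖ := norm_pos_iff.2 (arcDirection_ne_zero hd hb hdb ht)
  have hl : 0 < ‖d‖ := norm_pos_iff.2 hd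
  have hW := arcWeight_wronskian_pos hl ht
  rw [arcVelocity]
  refine smul_ne_zero (by positivity) fun h => ?_
  have h1 := congrArg (fun z => inner ℝ z (arcDirection d b t)) h
  simp only [inner_sub_left, inner_smul_left, real_inner_self_eq_norm_sq, inner_zero_left,
    conj_trivial, real_inner_comm (arcDirection d b t) b, inner_smul_right] at h1
  have h2 : inner ℝ (arcDirection d b t) b = 0 := by
    have : ‖d‖ * ‖arcDirection d b t‖ ^ 2 ≠ 0 := by positivity
    apply mul_left_cancel₀ this
    linear_combination h1
  rw [inner_smul_right, h2] at h
  simp [hd, hb, h0.ne'] at h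

theorem arcVelocity_zero {d b : V} (hd : d ≠ 0) (hb : ‖b‖ = 1) : arcVelocity d b 0 = b := by
  have hl : ‖d‖ ≠ 0 := by simpa using hd
  have : arcDirection d b 0 = (‖d‖ * ‖d‖) • b := by
    simp [arcDirection, arcWeight_zero, arcWeight_one]
  rw [arcVelocity, this]
  simp only [arcWeight_zero, arcWeight_one, sub_zero, inner_smul_left, inner_smul_right,
    real_inner_self_eq_norm_sq, hb, norm_smul, conj_trivial, norm_mul, norm_norm]
  match_scalars
  field_simp
  ring

/-- The next arc has to start with this velocity, which dictates the sign in the transport of `B`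
along the net. -/
theorem arcVelocity_one {d b : V} (hd : d ≠ 0) : arcVelocity d b 1 = - mirror d b := by
  have hl : ‖d‖ ≠ 0 := by simpa using hd
  have : arcDirection d b 1 = ‖d‖ • d := by simp [arcDirection, arcWeight_one, arcWeight_zero]
  rw [arcVelocity, this, mirror]
  simp only [arcWeight_zero, arcWeight_one, sub_self, inner_smul_left, inner_smul_right,
    norm_smul, conj_trivial, norm_norm, real_inner_comm d b]
  match_scalars
  · field_simp
    ring
  · field_simp
    ring

end Arc

/-! ### The strip between two curves and its normal field -/

/-- The linear map with partial derivatives `a` and `b`. -/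
noncomputable def partialsMap (a b : E3) : ℝ × ℝ →L[ℝ] E3 :=
  (ContinuousLinearMap.fst ℝ ℝ ℝ).smulRight a + (ContinuousLinearMap.snd ℝ ℝ ℝ).smulRight b

@[simp] theorem partialsMap_apply (a b : E3) (w : ℝ × ℝ) :
    partialsMap a b w = w.1 • a + w.2 • b := rfl

theorem hasFDerivAt_partialsMap {f : ℝ × ℝ → E3} {u v : ℝ} {a b : E3}
    (hf : DifferentiableAt ℝ f (u, v)) (ha : HasDerivAt (fun t => f (t, v)) a u)
    (hb : HasDerivAt (fun t => f (u, t)) b v) : HasFDerivAt f (partialsMap a b) (u, v) := by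
  have h1 : fderiv ℝ f (u, v) (1, 0) = a :=
    (hf.hasFDerivAt.comp_hasDerivAt u
      ((hasDerivAt_id u).prodMk (hasDerivAt_const u v))).unique ha
  have h2 : fderiv ℝ f (u, v) (0, 1) = b :=
    (hf.hasFDerivAt.comp_hasDerivAt v
      ((hasDerivAt_const v u).prodMk (hasDerivAt_id v))).unique hb
  convert hf.hasFDerivAt using 1
  refine ContinuousLinearMap.ext fun w => ?_
  rw [partialsMap_apply, ← h1, ← h2, ← map_smul, ← map_smul, ← map_add]
  congr 1
  ext <;> simp

/-- `L` is injective as soon as its second partial is nonzero and its first partial is not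
orthogonal to some vector orthogonal to the second. -/
theorem injective_of_inner {L : ℝ × ℝ →L[ℝ] E3} {n : E3} {c : ℝ} (hc : c ≠ 0)
    (hn : ∀ w, inner ℝ n (L w) = w.1 * c) (h2 : L (0, 1) ≠ 0) : Function.Injective L := by
  rw [injective_iff_map_eq_zero]
  rintro ⟨a, b⟩ hw
  have ha : a = 0 := by
    have := hn (a, b)
    rw [hw, inner_zero_right] at this
    simpa [hc] using this.symm
  subst ha
  have : L (0, b) = b • L (0, 1) := by rw [← map_smul]; simp
  rw [this, smul_eq_zero, or_iff_left h2] at hw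
  rw [hw]; rfl

/-- Two curves of a Ribaucour pair, with a parallel unit normal field and the orthogonal field
along the first, such that the circles determined by these are no straight lines. -/
structure IsStripData (I : Set ℝ) (x y N B : ℝ → E3) : Prop where
  pair : IsSmoothRibaucourPair I x y
  normal : IsParallelNormalField I x N
  contDiffOn : ContDiffOn ℝ ∞ B I
  norm_normal : ∀ u ∈ I, ‖N u‖ = 1
  norm_eq_one : ∀ u ∈ I, ‖B u‖ = 1
  inner_normal : ∀ u ∈ I, inner ℝ (N u) (B u) = 0
  inner_deriv : ∀ u ∈ I, inner ℝ (deriv x u) (B u) = 0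
  ne_smul : ∀ u ∈ I, ∀ c : ℝ, y u - x u ≠ c • B u

/-- The position of the points of the strip relative to the first curve. -/
noncomputable def stripVector (x y B : ℝ → E3) (k : ℤ) (p : ℝ × ℝ) : E3 :=
  arcChord (y p.1 - x p.1) (B p.1) (p.2 - k)

/-- The strip between two curves, composed of circular arcs. -/
noncomputable def strip (x y B : ℝ → E3) (k : ℤ) (p : ℝ × ℝ) : E3 :=
  x p.1 + stripVector x y B k p

/-- The normal field of `strip x y B k`. -/
noncomputable def stripNormal (x y N B : ℝ → E3) (k : ℤ) (p : ℝ × ℝ) : E3 :=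
  N p.1 - chordCurvature (y p.1 - x p.1) (N p.1) • stripVector x y B k p

/-- The open set on which the formula for the strip is regular. -/
def stripDomain (I : Set ℝ) (x y B : ℝ → E3) (k : ℤ) : Set (ℝ × ℝ) :=
  {p | p.1 ∈ I ∧ arcDirection (y p.1 - x p.1) (B p.1) (p.2 - k) ≠ 0}

namespace IsStripData

variable {I : Set ℝ} {x y N B : ℝ → E3} (k : ℤ)

theorem ne_zero (h : IsStripData I x y N B) {u : ℝ} (hu : u ∈ I) : B u ≠ 0 := by
  intro hz
  simpa [hz] using h.norm_eq_one u hu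

theorem contDiffOn_fst {V : Type*} [NormedAddCommGroup V] [NormedSpace ℝ V] {f : ℝ → V}
    (hf : ContDiffOn ℝ ∞ f I) : ContDiffOn ℝ ∞ (fun p : ℝ × ℝ => f p.1) (I ×ˢ Set.univ) :=
  hf.comp contDiff_fst.contDiffOn fun _ hp => hp.1

theorem contDiffOn_norm_sub (h : IsStripData I x y N B) :
    ContDiffOn ℝ ∞ (fun p : ℝ × ℝ => ‖y p.1 - x p.1‖) (I ×ˢ Set.univ) :=
  (contDiffOn_fst h.pair.contDiffOn_sub).norm ℝ fun _ hp => h.pair.sub_ne_zero hp.1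

theorem contDiffOn_arcWeight (h : IsStripData I x y N B) {g : ℝ × ℝ → ℝ} (hg : ContDiff ℝ ∞ g) :
    ContDiffOn ℝ ∞ (fun p : ℝ × ℝ => arcWeight ‖y p.1 - x p.1‖ (g p)) (I ×ˢ Set.univ) :=
  hg.contDiffOn.mul ((h.contDiffOn_norm_sub.mul hg.contDiffOn).add
    (contDiffOn_const.sub hg.contDiffOn))

theorem contDiffOn_arcDirection (h : IsStripData I x y N B) :
    ContDiffOn ℝ ∞ (fun p : ℝ × ℝ => arcDirection (y p.1 - x p.1) (B p.1) (p.2 - k))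
      (I ×ˢ Set.univ) :=
  ((h.contDiffOn_arcWeight (by fun_prop)).smul (contDiffOn_fst h.pair.contDiffOn_sub)).add
    (((h.contDiffOn_arcWeight (by fun_prop)).mul h.contDiffOn_norm_sub).smul
      (contDiffOn_fst h.contDiffOn))

theorem stripDomain_eq : stripDomain I x y B k = (I ×ˢ Set.univ) ∩
    (fun p : ℝ × ℝ => arcDirection (y p.1 - x p.1) (B p.1) (p.2 - k)) ⁻¹' {0}ᶜ := by
  ext p
  simp [stripDomain]

theorem isOpen_stripDomain (hI : IsOpen I) (h : IsStripData I x y N B) :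
    IsOpen (stripDomain I x y B k) := by
  rw [stripDomain_eq]
  exact (h.contDiffOn_arcDirection k).continuousOn.isOpen_inter_preimage (hI.prod isOpen_univ)
    isOpen_compl_singleton

theorem stripDomain_subset : stripDomain I x y B k ⊆ I ×ˢ Set.univ := fun _ hp => ⟨hp.1, trivial⟩

theorem sub_mem {v : ℝ} (hv : v ∈ Set.Icc (k : ℝ) (k + 1)) : v - k ∈ Set.Icc (0 : ℝ) 1 :=
  ⟨by linarith [hv.1], by linarith [hv.2]⟩

/-- The open domain contains the closed strip, so the formulas are smooth across both boundary
curves and `fderiv` is meaningful there. -/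
theorem mem_stripDomain (h : IsStripData I x y N B) {p : ℝ × ℝ}
    (hp : p ∈ I ×ˢ Set.Icc (k : ℝ) (k + 1)) : p ∈ stripDomain I x y B k :=
  ⟨hp.1, arcDirection_ne_zero (h.pair.sub_ne_zero hp.1) (h.ne_zero hp.1) (h.ne_smul p.1 hp.1)
    (sub_mem k hp.2)⟩

theorem contDiffOn_stripVector (h : IsStripData I x y N B) :
    ContDiffOn ℝ ∞ (stripVector x y B k) (stripDomain I x y B k) := by
  have hZ := (h.contDiffOn_arcDirection k).mono (stripDomain_subset (x := x) (y := y) (B := B) k)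
  have hA := (h.contDiffOn_arcWeight (g := fun p => p.2 - k) (by fun_prop)).mono
    (stripDomain_subset (x := x) (y := y) (B := B) k)
  have hl := h.contDiffOn_norm_sub.mono (stripDomain_subset (x := x) (y := y) (B := B) k)
  refine ContDiffOn.smul (((hl.pow 2).mul hA).div (hZ.norm_sq ℝ) fun p hp => ?_) hZ
  simpa using hp.2

theorem contDiffOn_strip (h : IsStripData I x y N B) :
    ContDiffOn ℝ ∞ (strip x y B k) (stripDomain I x y B k) :=
  ((contDiffOn_fst h.pair.left).mono (stripDomain_subset k)).add (h.contDiffOn_stripVector k)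

theorem contDiffOn_stripNormal (h : IsStripData I x y N B) :
    ContDiffOn ℝ ∞ (stripNormal x y N B k) (stripDomain I x y B k) :=
  ((contDiffOn_fst h.normal.contDiffOn).mono (stripDomain_subset k)).sub
    (((contDiffOn_fst (h.pair.contDiffOn_sub.chordCurvature h.normal.contDiffOn
      fun _ hu => h.pair.sub_ne_zero hu)).mono (stripDomain_subset k)).smul
      (h.contDiffOn_stripVector k))

theorem hasFDerivAt_strip (hI : IsOpen I) (h : IsStripData I x y N B) {p : ℝ × ℝ}
    (hp : p ∈ stripDomain I x y B k) :
    HasFDerivAt (strip x y B k) (fderiv ℝ (strip x y B k) p) p :=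
  (((h.contDiffOn_strip k).differentiableOn (by simp)).differentiableAt
    ((h.isOpen_stripDomain k hI).mem_nhds hp)).hasFDerivAt

theorem hasDerivAt_strip_snd (h : IsStripData I x y N B) {u v : ℝ}
    (hp : (u, v) ∈ stripDomain I x y B k) :
    HasDerivAt (fun t => strip x y B k (u, t)) (arcVelocity (y u - x u) (B u) (v - k)) v := by
  have h1 := (hasDerivAt_arcChord (h.norm_eq_one u hp.1) hp.2).scomp v
    ((hasDerivAt_id v).sub_const (k : ℝ))
  exact (h1.congr_deriv (one_smul ℝ _)).const_add (x u)

theorem fderiv_strip_snd (hI : IsOpen I) (h : IsStripData I x y N B) {u v : ℝ}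
    (hp : (u, v) ∈ stripDomain I x y B k) :
    fderiv ℝ (strip x y B k) (u, v) (0, 1) = arcVelocity (y u - x u) (B u) (v - k) :=
  ((h.hasFDerivAt_strip k hI hp).comp_hasDerivAt v
      ((hasDerivAt_const v u).prodMk (hasDerivAt_id v))).unique (h.hasDerivAt_strip_snd k hp)

theorem strip_left (u : ℝ) : strip x y B k (u, k) = x u := by
  simp [strip, stripVector, arcChord_zero]

theorem strip_right (h : IsStripData I x y N B) {u : ℝ} (hu : u ∈ I) :
    strip x y B k (u, k + 1) = y u := by
  simp [strip, stripVector, arcChord_one _ (h.pair.sub_ne_zero hu)]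

theorem stripNormal_left (u : ℝ) : stripNormal x y N B k (u, k) = N u := by
  simp [stripNormal, stripVector, arcChord_zero]

theorem stripNormal_right (h : IsStripData I x y N B) {u : ℝ} (hu : u ∈ I) :
    stripNormal x y N B k (u, k + 1) = mirror (y u - x u) (N u) := by
  simp [stripNormal, stripVector, arcChord_one _ (h.pair.sub_ne_zero hu),
    mirror_eq_sub_chordCurvature_smul]

theorem hasFDerivAt_strip_left (hI : IsOpen I) (h : IsStripData I x y N B) {u : ℝ} (hu : u ∈ I) :
    HasFDerivAt (strip x y B k) (partialsMap (deriv x u) (B u)) (u, (k : ℝ)) := by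
  have hp : (u, (k : ℝ)) ∈ stripDomain I x y B k := h.mem_stripDomain k ⟨hu, by simp⟩
  refine hasFDerivAt_partialsMap (h.hasFDerivAt_strip k hI hp).differentiableAt ?_ ?_
  · simp only [strip_left]
    exact hasDerivAt_of_contDiffOn hI h.pair.left hu
  · refine (h.hasDerivAt_strip_snd k hp).congr_deriv ?_
    rw [sub_self, arcVelocity_zero (h.pair.sub_ne_zero hu) (h.norm_eq_one u hu)]

theorem hasFDerivAt_strip_right (hI : IsOpen I) (h : IsStripData I x y N B) {u : ℝ} (hu : u ∈ I) :
    HasFDerivAt (strip x y B k) (partialsMap (deriv y u) (-mirror (y u - x u) (B u)))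
      (u, (k + 1 : ℝ)) := by
  have hp : (u, (k + 1 : ℝ)) ∈ stripDomain I x y B k := h.mem_stripDomain k ⟨hu, by simp⟩
  refine hasFDerivAt_partialsMap (h.hasFDerivAt_strip k hI hp).differentiableAt ?_ ?_
  · refine (hasDerivAt_of_contDiffOn hI h.pair.right hu).congr_of_eventuallyEq
      (Filter.eventuallyEq_of_mem (hI.mem_nhds hu) fun t ht => h.strip_right k ht)
  · refine (h.hasDerivAt_strip_snd k hp).congr_deriv ?_
    rw [add_sub_cancel_left, arcVelocity_one (h.pair.sub_ne_zero hu)]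

/-- The derivative of the incidence between the strip and a family of spheres that contain its
arcs. -/
theorem inner_fderiv_strip (hI : IsOpen I) (h : IsStripData I x y N B) {w : ℝ → E3} {σ : ℝ → ℝ}
    {p : ℝ × ℝ} {w' : E3} {σ' : ℝ} (hp : p ∈ stripDomain I x y B k)
    (hw : HasDerivAt w w' p.1) (hσ : HasDerivAt σ σ' p.1)
    (h1 : ∀ u ∈ I, inner ℝ (w u) (y u - x u) = σ u * ‖y u - x u‖ ^ 2)
    (h2 : ∀ u ∈ I, inner ℝ (w u) (B u) = 0) (v : ℝ × ℝ) :
    inner ℝ (w p.1 - (2 * σ p.1) • stripVector x y B k p) (fderiv ℝ (strip x y B k) p v) =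
      v.1 * (inner ℝ (w p.1) (deriv x p.1) -
        2 * σ p.1 * inner ℝ (stripVector x y B k p) (deriv x p.1) -
        inner ℝ w' (stripVector x y B k p) + σ' * ‖stripVector x y B k p‖ ^ 2) := by
  have hf := h.hasFDerivAt_strip k hI hp
  have hx := hasDerivAt_of_contDiffOn hI h.pair.left hp.1
  set L := fderiv ℝ (strip x y B k) p
  -- The incidence `(w, Y) = σ |Y|²` for `Y = stripVector` is differentiated along the line through
  -- `p` with direction `v`.
  have hline : HasDerivAt (fun s : ℝ => p + s • v) v 0 := by
    simpa using ((hasDerivAt_id (0 : ℝ)).smul_const v).const_add p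
  have hfst : HasDerivAt (fun s : ℝ => (p + s • v).1) v.1 0 := by
    simpa using ((hasDerivAt_id (0 : ℝ)).mul_const v.1).const_add p.1
  have hF : HasDerivAt (fun s : ℝ => strip x y B k (p + s • v)) (L v) 0 :=
    HasFDerivAt.comp_hasDerivAt (l := strip x y B k) (l' := L) (0 : ℝ) (by simpa using hf) hline
  have hX : HasDerivAt (fun s : ℝ => x (p + s • v).1) (v.1 • deriv x p.1) 0 :=
    HasDerivAt.scomp (0 : ℝ) (by simpa using hx) hfst
  have hW : HasDerivAt (fun s : ℝ => w (p + s • v).1) (v.1 • w') 0 :=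
    HasDerivAt.scomp (0 : ℝ) (by simpa using hw) hfst
  have hS : HasDerivAt (fun s : ℝ => σ (p + s • v).1) (σ' * v.1) 0 :=
    HasDerivAt.comp (0 : ℝ) (by simpa using hσ) hfst
  have hY : HasDerivAt (fun s : ℝ => stripVector x y B k (p + s • v)) (L v - v.1 • deriv x p.1) 0 :=
    (hF.sub hX).congr_of_eventuallyEq (Filter.Eventually.of_forall fun s => by simp [strip])
  have hQ := (hW.inner ℝ hY).sub (hS.mul hY.norm_sq)
  have h0 : ∀ᶠ s : ℝ in nhds 0, inner ℝ (w (p + s • v).1) (stripVector x y B k (p + s • v)) -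
      σ (p + s • v).1 * ‖stripVector x y B k (p + s • v)‖ ^ 2 = 0 := by
    have hc : ContinuousAt (fun s : ℝ => (p + s • v).1) 0 := hfst.continuousAt
    filter_upwards [hc.preimage_mem_nhds (hI.mem_nhds (by simpa using hp.1))] with s hs
    rw [stripVector, inner_arcChord (h1 _ hs) (h2 _ hs), sub_self]
  have := hQ.unique ((hasDerivAt_const (0 : ℝ) (0 : ℝ)).congr_of_eventuallyEq h0)
  simp only [zero_smul, add_zero, inner_sub_right, inner_smul_right, inner_smul_left,
    conj_trivial] at this
  rw [inner_sub_left, inner_smul_left, conj_trivial]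
  linear_combination this

/-- The arcs lie on the sphere through `x` and `y` that is orthogonal to `x` at the first point,
since they start in the direction `B ⊥ x'`. -/
theorem inner_deriv_stripVector (h : IsStripData I x y N B) {p : ℝ × ℝ} (hp : p.1 ∈ I) :
    inner ℝ (deriv x p.1) (stripVector x y B k p) =
      inner ℝ (deriv x p.1) (y p.1 - x p.1) / ‖y p.1 - x p.1‖ ^ 2 *
        ‖stripVector x y B k p‖ ^ 2 := by
  refine inner_arcChord ?_ (h.inner_deriv _ hp) _
  have : ‖y p.1 - x p.1‖ ^ 2 ≠ 0 := by simpa using h.pair.sub_ne_zero hp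
  exact (div_mul_cancel₀ _ this).symm

theorem inner_normal_stripVector (h : IsStripData I x y N B) {p : ℝ × ℝ} (hp : p.1 ∈ I) :
    inner ℝ (N p.1) (stripVector x y B k p) =
      chordCurvature (y p.1 - x p.1) (N p.1) / 2 * ‖stripVector x y B k p‖ ^ 2 := by
  refine inner_arcChord ?_ (h.inner_normal _ hp) _
  have : ‖y p.1 - x p.1‖ ^ 2 ≠ 0 := by simpa using h.pair.sub_ne_zero hp
  rw [chordCurvature, mul_div_assoc, mul_div_cancel_left₀ _ two_ne_zero, div_mul_cancel₀ _ this]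

theorem norm_stripNormal (h : IsStripData I x y N B) {p : ℝ × ℝ} (hp : p.1 ∈ I) :
    ‖stripNormal x y N B k p‖ = 1 := by
  rw [← sq_eq_sq₀ (norm_nonneg _) zero_le_one, stripNormal, norm_sub_sq_real, inner_smul_right,
    h.inner_normal_stripVector k hp, norm_smul, mul_pow, Real.norm_eq_abs, sq_abs,
    h.norm_normal _ hp]
  ring

theorem inner_fderiv_stripNormal (hI : IsOpen I) (h : IsStripData I x y N B) {p : ℝ × ℝ}
    (hp : p ∈ stripDomain I x y B k) (w : ℝ × ℝ) :
    inner ℝ (fderiv ℝ (strip x y B k) p w) (stripNormal x y N B k p) = 0 := by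
  obtain ⟨ρ, hρ⟩ := h.normal.hasDerivAt _ hp.1
  have horth := h.normal.orthogonal _ hp.1
  have hl := h.pair.hasDerivAt_chordCurvature hI hp.1 hρ horth
  -- Here `w = N` and `σ` is half the chord curvature `κ`. The terms `-κτ`, `-ρτ` and `τ(ρ + κ)`,
  -- all times the squared length of `stripVector`, add up to zero.
  have := h.inner_fderiv_strip k hI hp hρ (hl.div_const 2) (fun u hu => by
    have : ‖y u - x u‖ ^ 2 ≠ 0 := by simpa using h.pair.sub_ne_zero hu
    rw [chordCurvature, mul_div_assoc, mul_div_cancel_left₀ _ two_ne_zero,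
      div_mul_cancel₀ _ this]) h.inner_normal w
  rw [mul_div_cancel₀ _ two_ne_zero, horth, inner_smul_left, conj_trivial,
    real_inner_comm _ (stripVector x y B k p), h.inner_deriv_stripVector k hp.1] at this
  rw [real_inner_comm, stripNormal, this]
  ring

end IsStripData

/-! ### Singular points and enveloped spheres -/

section Arc

variable {V : Type*} [NormedAddCommGroup V] [InnerProductSpace ℝ V]

/-- The polynomial is nonzero because its value at `t = 0` is `q₂ l²`. -/
theorem finite_arcWeight_quadratic {l q₀ q₁ q₂ : ℝ} (hl : l ≠ 0) (hq : q₂ ≠ 0) :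
    {t : ℝ | q₀ * arcWeight l t ^ 2 + q₁ * (arcWeight l t * arcWeight l (1 - t)) +
      q₂ * arcWeight l (1 - t) ^ 2 = 0}.Finite := by
  let W : Polynomial ℝ := .X * (.C l * .X + (1 - .X))
  let W' : Polynomial ℝ := (1 - .X) * (.C l * (1 - .X) + (1 - (1 - .X)))
  let P : Polynomial ℝ := .C q₀ * W ^ 2 + .C q₁ * (W * W') + .C q₂ * W' ^ 2
  have hP : ∀ t, P.eval t = q₀ * arcWeight l t ^ 2 +
      q₁ * (arcWeight l t * arcWeight l (1 - t)) + q₂ * arcWeight l (1 - t) ^ 2 := by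
    intro t
    simp [P, W, W', arcWeight]
  have hP0 : P ≠ 0 := by
    intro h0
    have := hP 0
    simp [h0, arcWeight_zero, arcWeight_one, hl, hq] at this
  refine (Polynomial.finite_setOfPred_isRoot hP0).subset fun t ht => ?_
  rw [Set.mem_ofPred_eq, Polynomial.IsRoot, hP]
  exact ht

/-- An arc meets a sphere (or plane) that does not contain its starting point in finitely many
points. -/
theorem finite_arcChord_inter {d b z : V} {α e : ℝ} (hd : d ≠ 0) (hb : ‖b‖ = 1) (hα : α ≠ 0) :
    {t : ℝ | arcDirection d b t ≠ 0 ∧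
      α + inner ℝ z (arcChord d b t) + e * ‖arcChord d b t‖ ^ 2 = 0}.Finite := by
  have hl : ‖d‖ ≠ 0 := by simpa using hd
  -- The coefficients result from multiplying the equation by `‖arcDirection d b t‖ ^ 2` and
  -- expanding in the two weights.
  refine (finite_arcWeight_quadratic (l := ‖d‖)
    (q₀ := α * ‖d‖ ^ 2 + ‖d‖ ^ 2 * inner ℝ z d + e * ‖d‖ ^ 4)
    (q₁ := 2 * α * ‖d‖ * inner ℝ d b + ‖d‖ ^ 3 * inner ℝ z b)
    (q₂ := α * ‖d‖ ^ 2) hl (by positivity)).subset ?_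
  rintro t ⟨h0, ht⟩
  have hZ0 : ‖arcDirection d b t‖ ^ 2 ≠ 0 := by simpa using h0
  have hP : ‖arcDirection d b t‖ ^ 2 = arcWeight ‖d‖ t ^ 2 * ‖d‖ ^ 2 +
      2 * arcWeight ‖d‖ t * arcWeight ‖d‖ (1 - t) * ‖d‖ * inner ℝ d b +
      arcWeight ‖d‖ (1 - t) ^ 2 * ‖d‖ ^ 2 := by
    rw [arcDirection, norm_add_sq_real, norm_smul, norm_smul, inner_smul_left, inner_smul_right,
      hb, mul_pow, mul_pow, Real.norm_eq_abs, Real.norm_eq_abs, sq_abs, sq_abs]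
    simp only [conj_trivial]
    ring
  have hz : inner ℝ z (arcDirection d b t) =
      arcWeight ‖d‖ t * inner ℝ z d + arcWeight ‖d‖ (1 - t) * ‖d‖ * inner ℝ z b := by
    rw [arcDirection, inner_add_right, inner_smul_right, inner_smul_right]
  rw [norm_arcChord_sq, arcChord, inner_smul_right, hz] at ht
  have h2 := congrArg (fun r => ‖arcDirection d b t‖ ^ 2 * r) ht
  field_simp at h2
  rw [hP] at h2
  rw [Set.mem_ofPred_eq]
  linear_combination h2

end Arc

/-- The sphere (or plane) through `p` with unit normal `n` at `p` and curvature `c`. -/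
noncomputable def contactSphere (p n : E3) (c : ℝ) : MoebiusSpace :=
  (c, n + c • p, inner ℝ n p + c * ‖p‖ ^ 2 / 2)

theorem moebiusInner_contactSphere (p n m : E3) (c e : ℝ) :
    moebiusInner (contactSphere p n c) (contactSphere p m e) = inner ℝ n m := by
  simp only [moebiusInner, contactSphere, inner_add_left, inner_add_right, inner_smul_left,
    inner_smul_right, real_inner_self_eq_norm_sq, conj_trivial]
  rw [real_inner_comm m p]
  ring

theorem onSphere_contactSphere_iff (p n q : E3) (c : ℝ) :
    OnSphere (contactSphere p n c) q ↔ inner ℝ n (q - p) = c / 2 * ‖q - p‖ ^ 2 := by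
  rw [onSphere_iff, norm_sub_sq_real]
  simp only [contactSphere, inner_add_right, inner_sub_right, inner_smul_right]
  rw [real_inner_comm n q]
  constructor <;> intro h <;> linear_combination h

theorem sphereNormal_contactSphere (p n q : E3) (c : ℝ) :
    sphereNormal (contactSphere p n c) q = n - c • (q - p) := by
  simp only [sphereNormal, contactSphere]
  module

theorem ContDiffOn.contactSphere {I : Set ℝ} {p n : ℝ → E3} {c : ℝ → ℝ}
    (hp : ContDiffOn ℝ ∞ p I) (hn : ContDiffOn ℝ ∞ n I) (hc : ContDiffOn ℝ ∞ c I) :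
    ContDiffOn ℝ ∞ (fun u => contactSphere (p u) (n u) (c u)) I :=
  hc.prodMk ((hn.add (hc.smul hp)).prodMk
    ((hn.inner ℝ hp).add ((hc.mul (hp.norm_sq ℝ)).div_const 2)))

/-- For `c' = 2τ(ρ + c)` this is `ρ + c` times the incidence of `q` with the sphere through `p u`
that is orthogonal to the curve and contains the arcs. -/
theorem moebiusInner_deriv_contactSphere {p n : ℝ → E3} {c : ℝ → ℝ} {u ρ c' : ℝ} {p' : E3} (q : E3)
    (hp : HasDerivAt p p' u) (hn : HasDerivAt n (ρ • p') u) (hc : HasDerivAt c c' u)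
    (hnp : inner ℝ (n u) p' = 0) :
    moebiusInner (euclideanLift q) (deriv (fun t => contactSphere (p t) (n t) (c t)) u) =
      (ρ + c u) * inner ℝ p' (q - p u) - c' / 2 * ‖q - p u‖ ^ 2 := by
  have h := hc.prodMk ((hn.add (hc.smul hp)).prodMk
    ((hn.inner ℝ hp).add ((hc.mul hp.norm_sq).div_const 2)))
  have : deriv (fun t => contactSphere (p t) (n t) (c t)) u = _ := h.deriv
  rw [this, norm_sub_sq_real]
  simp only [moebiusInner, euclideanLift, inner_add_right, inner_sub_right, inner_smul_left,
    inner_smul_right, conj_trivial, hnp, real_inner_comm p' q, real_inner_comm p' (p u)]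
  ring

namespace IsStripData

variable {I : Set ℝ} {x y N B : ℝ → E3} (k : ℤ)

theorem injOn_strip (h : IsStripData I x y N B) {u : ℝ} (hu : u ∈ I) :
    Set.InjOn (fun v => strip x y B k (u, v)) (Set.Icc (k : ℝ) (k + 1)) := by
  intro v hv w hw hvw
  have := arcChord_injOn (h.pair.sub_ne_zero hu) (h.ne_zero hu) (h.ne_smul u hu)
    (sub_mem k hv) (sub_mem k hw) (add_left_cancel hvw)
  linarith

theorem contDiffOn_deriv (hI : IsOpen I) (h : IsStripData I x y N B) :
    ContDiffOn ℝ ∞ (deriv x) I := h.pair.left.deriv_of_isOpen hI (by simp)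

theorem isChannelSurface (hI : IsOpen I) (h : IsStripData I x y N B) {f M : ℝ × ℝ → E3}
    (hf : ∀ p ∈ I ×ˢ Set.Icc (k : ℝ) (k + 1), f p = strip x y B k p)
    (hM : ∀ p ∈ I ×ˢ Set.Icc (k : ℝ) (k + 1), M p = stripNormal x y N B k p) :
    IsChannelSurface I (Set.Icc (k : ℝ) (k + 1)) f M := by
  refine ⟨((h.contDiffOn_strip k).mono fun p hp => h.mem_stripDomain k hp).congr hf, ?_⟩
  have hT := (h.contDiffOn_deriv hI).normalize h.pair.left_ne
  have hd0 : ∀ u ∈ I, y u - x u ≠ 0 := fun u hu => h.pair.sub_ne_zero hu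
  -- The enveloped sphere has normal `N`; the second sphere has the unit tangent as normal. Both
  -- pass through `x u` and `y u`, and they meet in the circle of the arc.
  refine ⟨fun u => contactSphere (x u) (N u) (chordCurvature (y u - x u) (N u)),
    fun u => contactSphere (x u) (‖deriv x u‖⁻¹ • deriv x u)
      (chordCurvature (y u - x u) (‖deriv x u‖⁻¹ • deriv x u)),
    h.pair.left.contactSphere h.normal.contDiffOn
      (h.pair.contDiffOn_sub.chordCurvature h.normal.contDiffOn hd0),
    h.pair.left.contactSphere hT (h.pair.contDiffOn_sub.chordCurvature hT hd0), fun u hu => ?_⟩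
  refine ⟨⟨?_, ?_, ?_⟩, ?_, fun v hv => ?_⟩
  · simp [IsOrientedSphere, moebiusInner_contactSphere, h.norm_normal u hu]
  · simp [IsOrientedSphere, moebiusInner_contactSphere, norm_smul, h.pair.left_ne u hu]
  · simp [moebiusInner_contactSphere, inner_smul_right, h.normal.orthogonal u hu]
  · exact (h.injOn_strip k hu).congr fun v hv => (hf (u, v) ⟨hu, hv⟩).symm
  · rw [hf (u, v) ⟨hu, hv⟩, hM (u, v) ⟨hu, hv⟩]
    have hsub : strip x y B k (u, v) - x u = stripVector x y B k (u, v) := add_sub_cancel_left _ _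
    refine ⟨⟨?_, ?_⟩, ?_, ?_⟩
    · rw [onSphere_contactSphere_iff, hsub]
      exact h.inner_normal_stripVector k (p := (u, v)) hu
    · rw [onSphere_contactSphere_iff, hsub, inner_smul_left,
        h.inner_deriv_stripVector k (p := (u, v)) hu, chordCurvature, inner_smul_left]
      ring
    · obtain ⟨ρ, hρ⟩ := h.normal.hasDerivAt u hu
      have horth := h.normal.orthogonal u hu
      rw [moebiusInner_deriv_contactSphere _ (hasDerivAt_of_contDiffOn hI h.pair.left hu) hρ
        (h.pair.hasDerivAt_chordCurvature hI hu hρ horth) horth, hsub,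
        h.inner_deriv_stripVector k (p := (u, v)) hu]
      ring
    · rw [sphereNormal_contactSphere, hsub]
      rfl

theorem finite_not_injective (hI : IsOpen I) (h : IsStripData I x y N B) {u : ℝ} (hu : u ∈ I) :
    {v ∈ Set.Icc (k : ℝ) (k + 1) |
      ¬ Function.Injective (fderiv ℝ (strip x y B k) (u, v))}.Finite := by
  have hd0 := h.pair.sub_ne_zero hu
  have hx' := h.contDiffOn_deriv hI
  have hσ := (h.pair.contDiffOn_sub.chordCurvature hx' fun u hu => h.pair.sub_ne_zero hu).div_const 2
  -- By `inner_fderiv_strip` with `w = x'`, the strip is immersed where this expression is nonzero: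
  -- the vector `n` below is normal to the sphere orthogonal to `x`, hence to the arc, and detects
  -- the `u`-derivative. The constant term `‖deriv x u‖ ^ 2` is the value at the first curve.
  refine ((finite_arcChord_inter (z := -(chordCurvature (y u - x u) (deriv x u) • deriv x u) -
      deriv (deriv x) u) (α := ‖deriv x u‖ ^ 2)
    (e := deriv (fun u => chordCurvature (y u - x u) (deriv x u) / 2) u) hd0
    (h.norm_eq_one u hu) (by simpa using h.pair.left_ne u hu)).image (· + (k : ℝ))).subset ?_
  rintro v ⟨hv, hinj⟩
  refine ⟨v - k, ⟨arcDirection_ne_zero hd0 (h.ne_zero hu) (h.ne_smul u hu) (sub_mem k hv), ?_⟩,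
    sub_add_cancel _ _⟩
  by_contra hc
  have hp : (u, v) ∈ stripDomain I x y B k := h.mem_stripDomain k ⟨hu, hv⟩
  refine hinj (injective_of_inner (n := deriv x u -
    (2 * (chordCurvature (y u - x u) (deriv x u) / 2)) • stripVector x y B k (u, v))
    hc (fun w => ?_) ?_)
  · refine (h.inner_fderiv_strip k hI hp (hasDerivAt_of_contDiffOn hI hx' hu)
      (hasDerivAt_of_contDiffOn hI hσ hu) (fun u hu => ?_) h.inner_deriv w).trans ?_
    · have : ‖y u - x u‖ ^ 2 ≠ 0 := by simpa using h.pair.sub_ne_zero hu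
      rw [chordCurvature, mul_div_assoc, mul_div_cancel_left₀ _ two_ne_zero,
        div_mul_cancel₀ _ this]
    · simp only [real_inner_self_eq_norm_sq, inner_sub_left, inner_neg_left, inner_smul_left,
        conj_trivial, stripVector, real_inner_comm (deriv x u)]
      ring
  · rw [h.fderiv_strip_snd k hI hp]
    exact arcVelocity_ne_zero hd0 (h.ne_zero hu) (h.ne_smul u hu) (sub_mem k hv)

end IsStripData

/-! ### Gluing strips along common boundary curves -/

theorem mem_Icc_union_floor (v : ℝ) :
    Set.Icc ((⌊v⌋ - 1 : ℤ) : ℝ) ((⌊v⌋ - 1 : ℤ) + 1) ∪ Set.Icc (⌊v⌋ : ℝ) (⌊v⌋ + 1) ∈ nhds v := by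
  have h1 := Int.floor_le v
  have h2 := Int.lt_floor_add_one v
  filter_upwards [Ioo_mem_nhds (show (⌊v⌋ : ℝ) - 1 < v by linarith) h2] with t ht
  push_cast
  rcases le_total t ⌊v⌋ with h | h
  · exact Or.inl ⟨by linarith [ht.1], by linarith⟩
  · exact Or.inr ⟨h, ht.2.le⟩

theorem prod_mem_nhds_floor {I : Set ℝ} (hI : IsOpen I) {p : ℝ × ℝ} (hp : p.1 ∈ I) :
    I ×ˢ Set.Icc ((⌊p.2⌋ - 1 : ℤ) : ℝ) ((⌊p.2⌋ - 1 : ℤ) + 1) ∪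
      I ×ˢ Set.Icc (⌊p.2⌋ : ℝ) (⌊p.2⌋ + 1) ∈ nhds p := by
  rw [← Set.prod_union]
  exact prod_mem_nhds (hI.mem_nhds hp) (mem_Icc_union_floor p.2)

theorem notMem_closure_prod_Icc {I : Set ℝ} {k : ℤ} {p : ℝ × ℝ} (hp : p.1 ∈ I)
    (h : p ∉ I ×ˢ Set.Icc (k : ℝ) (k + 1)) : p ∉ closure (I ×ˢ Set.Icc (k : ℝ) (k + 1)) := by
  rw [closure_prod_eq, isClosed_Icc.closure_eq]
  exact fun hc => h ⟨hp, hc.2⟩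

/-- The map that is composed of the maps `g k` on the strips `[k, k + 1]`. -/
noncomputable def glue {W : Type*} (g : ℤ → ℝ × ℝ → W) (p : ℝ × ℝ) : W := g ⌊p.2⌋ p

theorem glue_eq {W : Type*} {I : Set ℝ} {g : ℤ → ℝ × ℝ → W}
    (hg : ∀ k : ℤ, ∀ u ∈ I, g k (u, k + 1) = g (k + 1) (u, k + 1)) {k : ℤ} {p : ℝ × ℝ}
    (hp : p ∈ I ×ˢ Set.Icc (k : ℝ) (k + 1)) : glue g p = g k p := by
  obtain ⟨u, v⟩ := p
  obtain ⟨hu, h1, h2⟩ := hp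
  dsimp at hu h1 h2
  rcases h2.eq_or_lt with rfl | h2
  -- At the upper boundary the floor already selects the next map, so the matching condition is
  -- needed.
  · have : ⌊(k : ℝ) + 1⌋ = k + 1 := by simp
    rw [glue, this, hg k u hu]
  · have : ⌊v⌋ = k := Int.floor_eq_iff.2 ⟨h1, h2⟩
    rw [glue, this]

theorem continuousOn_glue {W : Type*} [TopologicalSpace W] {I : Set ℝ} (hI : IsOpen I)
    {g : ℤ → ℝ × ℝ → W} (hg : ∀ k : ℤ, ∀ u ∈ I, g k (u, k + 1) = g (k + 1) (u, k + 1))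
    (hc : ∀ k : ℤ, ContinuousOn (g k) (I ×ˢ Set.Icc (k : ℝ) (k + 1))) :
    ContinuousOn (glue g) (I ×ˢ Set.univ) := by
  rintro p ⟨hp, -⟩
  -- Away from the closed strip the claim is vacuous, so two adjacent strips can always be united to
  -- a neighbourhood.
  have key : ∀ k : ℤ, ContinuousWithinAt (glue g) (I ×ˢ Set.Icc (k : ℝ) (k + 1)) p := by
    intro k
    by_cases h : p ∈ I ×ˢ Set.Icc (k : ℝ) (k + 1)
    · exact (hc k p h).congr (fun q hq => glue_eq hg hq) (glue_eq hg h)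
    · exact continuousWithinAt_of_notMem_closure (notMem_closure_prod_Icc hp h)
  exact (((key (⌊p.2⌋ - 1)).union (key ⌊p.2⌋)).continuousAt
    (prod_mem_nhds_floor hI hp)).continuousWithinAt

theorem hasFDerivAt_glue {I : Set ℝ} (hI : IsOpen I) {g : ℤ → ℝ × ℝ → E3}
    (hg : ∀ k : ℤ, ∀ u ∈ I, g k (u, k + 1) = g (k + 1) (u, k + 1))
    (hg' : ∀ k : ℤ, ∀ u ∈ I, fderiv ℝ (g k) (u, k + 1) = fderiv ℝ (g (k + 1)) (u, k + 1))
    (hd : ∀ k : ℤ, ∀ p ∈ I ×ˢ Set.Icc (k : ℝ) (k + 1), DifferentiableAt ℝ (g k) p)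
    {p : ℝ × ℝ} (hp : p.1 ∈ I) :
    HasFDerivAt (glue g) (glue (fun k => fderiv ℝ (g k)) p) p := by
  have key : ∀ k : ℤ, HasFDerivWithinAt (glue g) (glue (fun k => fderiv ℝ (g k)) p)
      (I ×ˢ Set.Icc (k : ℝ) (k + 1)) p := by
    intro k
    by_cases h : p ∈ I ×ˢ Set.Icc (k : ℝ) (k + 1)
    · rw [glue_eq hg' h]
      exact (hd k p h).hasFDerivAt.hasFDerivWithinAt.congr (fun q hq => glue_eq hg hq)
        (glue_eq hg h)
    · exact .of_notMem_closure (notMem_closure_prod_Icc hp h)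
  exact ((key (⌊p.2⌋ - 1)).union (key ⌊p.2⌋)).hasFDerivAt (prod_mem_nhds_floor hI hp)

/-- A `C¹` strip over `[k, k + 1]` with a continuous unit normal field. -/
structure IsC1Strip (I : Set ℝ) (k : ℤ) (g M : ℝ × ℝ → E3) : Prop where
  differentiableAt : ∀ p ∈ I ×ˢ Set.Icc (k : ℝ) (k + 1), DifferentiableAt ℝ g p
  continuousOn_fderiv : ContinuousOn (fderiv ℝ g) (I ×ˢ Set.Icc (k : ℝ) (k + 1))
  continuousOn_normal : ContinuousOn M (I ×ˢ Set.Icc (k : ℝ) (k + 1))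
  norm_normal : ∀ p ∈ I ×ˢ Set.Icc (k : ℝ) (k + 1), ‖M p‖ = 1
  orthogonal : ∀ p ∈ I ×ˢ Set.Icc (k : ℝ) (k + 1), ∀ w, inner ℝ (fderiv ℝ g p w) (M p) = 0

theorem isC1SurfaceWithNormal_glue {I : Set ℝ} (hI : IsOpen I) {g M : ℤ → ℝ × ℝ → E3}
    (h : ∀ k, IsC1Strip I k (g k) (M k))
    (hg : ∀ k : ℤ, ∀ u ∈ I, g k (u, k + 1) = g (k + 1) (u, k + 1))
    (hg' : ∀ k : ℤ, ∀ u ∈ I, fderiv ℝ (g k) (u, k + 1) = fderiv ℝ (g (k + 1)) (u, k + 1))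
    (hM : ∀ k : ℤ, ∀ u ∈ I, M k (u, k + 1) = M (k + 1) (u, k + 1)) :
    IsC1SurfaceWithNormal I (glue g) (glue M) := by
  have hd := fun {p : ℝ × ℝ} (hp : p.1 ∈ I) =>
    hasFDerivAt_glue hI hg hg' (fun k => (h k).differentiableAt) hp
  have hmem : ∀ p ∈ I ×ˢ (Set.univ : Set ℝ), p ∈ I ×ˢ Set.Icc (⌊p.2⌋ : ℝ) (⌊p.2⌋ + 1) :=
    fun p hp => ⟨hp.1, Int.floor_le _, (Int.lt_floor_add_one _).le⟩
  refine ⟨?_, continuousOn_glue hI hM fun k => (h k).continuousOn_normal,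
    fun p hp => (h _).norm_normal p (hmem p hp), fun p hp w => ?_⟩
  · rw [show (1 : WithTop ℕ∞) = 0 + 1 by simp,
      contDiffOn_succ_iff_fderiv_of_isOpen (hI.prod isOpen_univ)]
    refine ⟨fun p hp => (hd hp.1).differentiableAt.differentiableWithinAt, by simp, ?_⟩
    rw [contDiffOn_zero]
    exact (continuousOn_glue hI hg' fun k => (h k).continuousOn_fderiv).congr
      fun p hp => (hd hp.1).fderiv
  · rw [(hd hp.1).fderiv]
    exact (h _).orthogonal p (hmem p hp) w

theorem IsStripData.isC1Strip {I : Set ℝ} {x y N B : ℝ → E3} (k : ℤ) (hI : IsOpen I)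
    (h : IsStripData I x y N B) : IsC1Strip I k (strip x y B k) (stripNormal x y N B k) where
  differentiableAt p hp := (h.hasFDerivAt_strip k hI (h.mem_stripDomain k hp)).differentiableAt
  continuousOn_fderiv := ((h.contDiffOn_strip k).continuousOn_fderiv_of_isOpen
    (h.isOpen_stripDomain k hI) (by simp)).mono fun p hp => h.mem_stripDomain k hp
  continuousOn_normal := (h.contDiffOn_stripNormal k).continuousOn.mono
    fun p hp => h.mem_stripDomain k hp
  norm_normal p hp := h.norm_stripNormal k hp.1
  orthogonal p hp := h.inner_fderiv_stripNormal k hI (h.mem_stripDomain k hp)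

/-! ### Ruled strips beyond the ends of the net -/

/-- The developable strip with rulings `B` along the curve `x`, for the parameter value `k`. -/
noncomputable def ruledStrip (x B : ℝ → E3) (k : ℤ) (p : ℝ × ℝ) : E3 :=
  x p.1 + (p.2 - k) • B p.1

theorem contDiffOn_ruledStrip {I : Set ℝ} {x B : ℝ → E3} (k : ℤ) (hx : ContDiffOn ℝ ∞ x I)
    (hB : ContDiffOn ℝ ∞ B I) : ContDiffOn ℝ ∞ (ruledStrip x B k) (I ×ˢ Set.univ) :=
  (IsStripData.contDiffOn_fst hx).add
    ((contDiff_snd.contDiffOn.sub contDiffOn_const).smul (IsStripData.contDiffOn_fst hB))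

theorem hasFDerivAt_ruledStrip {I : Set ℝ} (hI : IsOpen I) {x B : ℝ → E3} (k : ℤ)
    (hx : ContDiffOn ℝ ∞ x I) (hB : ContDiffOn ℝ ∞ B I) {u : ℝ} (hu : u ∈ I) (v : ℝ) :
    HasFDerivAt (ruledStrip x B k) (partialsMap (deriv x u + (v - k) • deriv B u) (B u)) (u, v) := by
  refine hasFDerivAt_partialsMap (((contDiffOn_ruledStrip k hx hB).differentiableOn
    (by simp)).differentiableAt ((hI.prod isOpen_univ).mem_nhds ⟨hu, trivial⟩)) ?_ ?_
  · exact (hasDerivAt_of_contDiffOn hI hx hu).add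
      ((hasDerivAt_of_contDiffOn hI hB hu).const_smul (v - k : ℝ))
  · have := ((((hasDerivAt_id v).sub_const (k : ℝ)).smul_const (B u))).const_add (x u)
    exact this.congr_deriv (one_smul _ _)

/-- The parameter interval `j` is independent of `k`, since one ruled surface has to cover all
strips beyond an end of the net. -/
theorem isC1Strip_ruledStrip {I : Set ℝ} (hI : IsOpen I) {x N B : ℝ → E3} (k j : ℤ)
    (hx : ContDiffOn ℝ ∞ x I) (hN : IsParallelNormalField I x N) (hB : ContDiffOn ℝ ∞ B I)
    (hN1 : ∀ u ∈ I, ‖N u‖ = 1) (hNB : ∀ u ∈ I, inner ℝ (N u) (B u) = 0)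
    (hBx : ∀ u ∈ I, inner ℝ (deriv x u) (B u) = 0) :
    IsC1Strip I j (ruledStrip x B k) (fun p => N p.1) where
  differentiableAt p hp := (hasFDerivAt_ruledStrip hI k hx hB hp.1 p.2).differentiableAt
  continuousOn_fderiv := ((contDiffOn_ruledStrip k hx hB).continuousOn_fderiv_of_isOpen
    (hI.prod isOpen_univ) (by simp)).mono (Set.prod_mono subset_rfl (Set.subset_univ _))
  continuousOn_normal := (IsStripData.contDiffOn_fst hN.contDiffOn).continuousOn.mono
    (Set.prod_mono subset_rfl (Set.subset_univ _))
  norm_normal p hp := hN1 _ hp.1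
  orthogonal := by
    rintro ⟨u, v⟩ ⟨hu, -⟩ w
    dsimp only at hu ⊢
    obtain ⟨ρ, hρ⟩ := hN.hasDerivAt u hu
    -- Differentiating `(N, B) = 0` with `N' ∥ x' ⊥ B` gives `(N, B') = 0`, so `N` stays normal
    -- along the rulings.
    have h0 := (hρ.inner ℝ (hasDerivAt_of_contDiffOn hI hB hu)).unique
      ((hasDerivAt_const u (0 : ℝ)).congr_of_eventuallyEq
        (Filter.eventuallyEq_of_mem (hI.mem_nhds hu) hNB))
    rw [inner_smul_left, hBx u hu, mul_zero, add_zero] at h0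
    rw [(hasFDerivAt_ruledStrip hI k hx hB hu v).fderiv, partialsMap_apply, real_inner_comm]
    simp only [inner_add_right, inner_smul_right, hN.orthogonal u hu, h0, hNB u hu]
    ring

/-! ### Transport of frames along the net -/

/-- An involutive step can be undone by itself, so the recursion also runs downwards from `k₀`. -/
theorem exists_int_sequence {α : Type*} {e : ℤ → α → α} (he : ∀ k, Function.Involutive (e k))
    (k₀ : ℤ) (a : α) : ∃ g : ℤ → α, g k₀ = a ∧ ∀ k, g (k + 1) = e k (g k) := by
  let F : ℕ → α := fun n => Nat.rec a (fun n z => e (k₀ + n) z) n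
  let G : ℕ → α := fun n => Nat.rec a (fun n z => e (k₀ - n - 1) z) n
  have hF : ∀ n, F (n + 1) = e (k₀ + n) (F n) := fun n => rfl
  have hG : ∀ n, G (n + 1) = e (k₀ - n - 1) (G n) := fun n => rfl
  have h0 : F 0 = G 0 := rfl
  let g : ℤ → α := fun k => if k₀ ≤ k then F (k - k₀).toNat else G (k₀ - k).toNat
  have hg : ∀ n : ℕ, g (k₀ - n) = G n := by
    intro n
    rcases n.eq_zero_or_pos with rfl | hn
    · simp [g, h0]
    · have : ¬ k₀ ≤ k₀ - n := by omega
      simp [g, this]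
  refine ⟨g, by simp [g, F], fun k => ?_⟩
  rcases le_or_gt k₀ k with h | h
  · obtain ⟨n, rfl⟩ := Int.le.dest h
    have h2 : k₀ ≤ k₀ + n + 1 := by omega
    have h3 : (k₀ + n + 1 - k₀).toNat = n + 1 := by omega
    have h4 : (k₀ + n - k₀).toNat = n := by omega
    simp only [g, if_pos h, if_pos h2, h3, h4, hF]
  · obtain ⟨n, hn⟩ := Int.le.dest (show k + 1 ≤ k₀ by omega)
    have h1 : k + 1 = k₀ - n := by omega
    have h2 : k = k₀ - (n + 1 : ℕ) := by omega
    have h3 : k = k₀ - n - 1 := by omega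
    rw [h1, hg]
    conv_rhs => rw [h2, hg, hG, ← h2, ← h3]
    exact (he k _).symm

/-- The nearest-point retraction: beyond its ends the net is continued by the ruled surface of the
curve `c k`, and the last property makes this surface the same on adjacent strips. -/
theorem exists_int_retraction {J : Set ℤ} (hJ : J.OrdConnected) (hne : J.Nonempty) :
    ∃ c : ℤ → ℤ, (∀ k, c k ∈ J) ∧ (∀ k ∈ J, c k = k) ∧
      ∀ k, ¬ (k ∈ J ∧ k + 1 ∈ J) → c k = c (k + 1) := by
  classical
  have hmax : ∀ k ∉ J, (∃ j ∈ J, j < k) → k ∈ upperBounds J := by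
    rintro k hk ⟨j, hj, hjk⟩ i hi
    by_contra! h
    exact hk (hJ.out hj hi ⟨hjk.le, h.le⟩)
  have hmin : ∀ k ∉ J, (¬ ∃ j ∈ J, j < k) → k ∈ lowerBounds J := by
    intro k hk h i hi
    by_contra! hik
    exact h ⟨i, hi, hik⟩
  refine ⟨fun k => if k ∈ J then k else if ∃ j ∈ J, j < k then sSup J else sInf J,
    fun k => ?_, fun k hk => if_pos hk, fun k hk => ?_⟩
  · dsimp only
    split_ifs with h1 h2
    · exact h1
    · exact Int.csSup_mem hne ⟨k, hmax k h1 h2⟩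
    · exact Int.csInf_mem hne ⟨k, hmin k h1 h2⟩
  · dsimp only
    by_cases h1 : k ∈ J
    · have h2 : k + 1 ∉ J := fun h => hk ⟨h1, h⟩
      have h3 : ∃ j ∈ J, j < k + 1 := ⟨k, h1, by omega⟩
      rw [if_pos h1, if_neg h2, if_pos h3]
      have h4 : IsGreatest J k := ⟨h1, fun i hi => by
        have h5 := hmax _ h2 h3 hi
        have h6 : i ≠ k + 1 := by rintro rfl; exact h2 hi
        omega⟩
      exact h4.csSup_eq.symm
    · by_cases h2 : k + 1 ∈ J
      · have h3 : ¬ ∃ j ∈ J, j < k := by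
          intro h
          have := hmax k h1 h h2
          omega
        rw [if_neg h1, if_neg h3, if_pos h2]
        have h4 : IsLeast J (k + 1) := ⟨h2, fun i hi => by
          have h5 := hmin k h1 h3 hi
          have h6 : i ≠ k := by rintro rfl; exact h1 hi
          omega⟩
        exact h4.csInf_eq
      · have h3 : (∃ j ∈ J, j < k) ↔ ∃ j ∈ J, j < k + 1 := by
          refine exists_congr fun j => and_congr_right fun hj => ?_
          have : j ≠ k := by rintro rfl; exact h1 hj
          omega
        simp only [if_neg h1, if_neg h2, h3]

namespace IsSemiDiscreteCurvatureLineNet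

variable {I : Set ℝ} {J : Set ℤ} {x : ℤ → ℝ → E3}

theorem isSmoothRibaucourPair (hx : IsSemiDiscreteCurvatureLineNet I J x) {k : ℤ} (hk : k ∈ J)
    (hk1 : k + 1 ∈ J) : IsSmoothRibaucourPair I (x k) (x (k + 1)) :=
  ⟨hx.smooth k hk, hx.smooth _ hk1, hx.regular k hk, hx.regular _ hk1, hx.ribaucour k hk hk1⟩

/-- Parallel frames along the curves of a net that are related by reflections. -/
theorem exists_isParallelFrame (hI : IsOpen I) (hI' : I.OrdConnected) (hJ : J.OrdConnected)
    (hne : J.Nonempty) (hx : IsSemiDiscreteCurvatureLineNet I J x) :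
    ∃ n b : ℤ → ℝ → E3, (∀ k ∈ J, IsParallelFrame I (x k) (n k) (b k)) ∧
      (∀ k u, n (k + 1) u = mirror (x (k + 1) u - x k u) (n k u)) ∧
      ∀ k u, b (k + 1) u = mirror (x (k + 1) u - x k u) (b k u) := by
  obtain ⟨k₀, hk₀⟩ := hne
  obtain ⟨n₀, b₀, h₀⟩ := _root_.exists_isParallelFrame hI hI' (hx.smooth k₀ hk₀) (hx.regular k₀ hk₀)
  -- This also covers indices outside `J`, where the points may coincide and the reflection is the
  -- identity.
  have he : ∀ k : ℤ, Function.Involutive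
      (fun (n : ℝ → E3) u => mirror (x (k + 1) u - x k u) (n u)) :=
    fun k n => funext fun u => mirror_mirror _ _
  obtain ⟨n, hn0, hn⟩ := exists_int_sequence he k₀ n₀
  obtain ⟨b, hb0, hb⟩ := exists_int_sequence he k₀ b₀
  refine ⟨n, b, fun k hk => ?_, fun k u => congrFun (hn k) u, fun k u => congrFun (hb k) u⟩
  rcases le_total k₀ k with h | h
  · induction k, h using Int.leInduction with
    | base => rwa [hn0, hb0]
    | succ k h ih =>
      have hkJ : k ∈ J := hJ.out hk₀ hk ⟨h, by omega⟩
      rw [hn, hb]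
      exact (ih hkJ).mirror hI (hx.isSmoothRibaucourPair hkJ hk)
  · induction k, h using Int.leInductionDown with
    | base => rwa [hn0, hb0]
    | pred k h ih =>
      have hkJ : k ∈ J := hJ.out hk hk₀ ⟨by omega, h⟩
      have e : k - 1 + 1 = k := by omega
      have hp := hx.isSmoothRibaucourPair hk (e.symm ▸ hkJ)
      have hn' := hn (k - 1)
      have hb' := hb (k - 1)
      rw [e] at hp hn' hb'
      have := (ih hkJ).mirror hI hp.symm
      rw [hn', hb'] at this
      convert this using 1
      all_goals
        funext u
        dsimp only
        rw [← neg_sub (x k u), mirror_neg_left, mirror_mirror]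

/-- Parallel unit normal fields along the curves of a net that determine smoothing channel
surfaces: the circles that they define are no straight lines. -/
theorem exists_generic_isParallelFrame (hI : IsOpen I) (hI' : I.OrdConnected)
    (hJ : J.OrdConnected) (hne : J.Nonempty) (hx : IsSemiDiscreteCurvatureLineNet I J x) :
    ∃ N B : ℤ → ℝ → E3, (∀ k ∈ J, IsParallelFrame I (x k) (N k) (B k)) ∧
      (∀ k u, N (k + 1) u = mirror (x (k + 1) u - x k u) (N k u)) ∧
      (∀ k u, B (k + 1) u = -mirror (x (k + 1) u - x k u) (B k u)) ∧
      ∀ k ∈ J, k + 1 ∈ J → ∀ u ∈ I, ∀ c : ℝ, x (k + 1) u - x k u ≠ c • B k u := by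
  obtain ⟨n, b, hf, hn, hb⟩ := hx.exists_isParallelFrame hI hI' hJ hne
  obtain ⟨m, hm⟩ : ∃ m : ℝ, ∀ k ∈ J, k + 1 ∈ J → ∀ u ∈ I,
      inner ℝ (x (k + 1) u - x k u) (deriv (x k) u) = 0 →
      inner ℝ (x (k + 1) u - x k u) (n k u + m • b k u) ≠ 0 := by
    by_contra! hc
    -- Each of the countably many pairs excludes only a null set of slopes `m`.
    have h0 : MeasureTheory.volume (⋃ k : {k : ℤ // k ∈ J ∧ k + 1 ∈ J},
        {m : ℝ | ∃ u ∈ I, inner ℝ (x (k.1 + 1) u - x k.1 u) (deriv (x k.1) u) = 0 ∧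
          inner ℝ (x (k.1 + 1) u - x k.1 u) (n k.1 u + m • b k.1 u) = 0}) = 0 :=
      MeasureTheory.measure_iUnion_null fun k =>
        (hx.isSmoothRibaucourPair k.2.1 k.2.2).volume_setOf_orthogonal hI (hf k.1 k.2.1)
    have huniv : MeasureTheory.volume (Set.univ : Set ℝ) ≠ 0 := by simp
    refine huniv (MeasureTheory.measure_mono_null (fun m _ => ?_) h0)
    obtain ⟨k, hk, hk1, u, hu, h1, h2⟩ := hc m
    exact Set.mem_iUnion.2 ⟨⟨k, hk, hk1⟩, u, hu, h1, h2⟩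
  -- The factor `c` normalizes `n + m • b`.
  obtain ⟨c, hc0, hc⟩ : ∃ c : ℝ, c ≠ 0 ∧ c ^ 2 * (1 + m ^ 2) = 1 := by
    have h : 0 < 1 + m ^ 2 := by positivity
    refine ⟨(Real.sqrt (1 + m ^ 2))⁻¹, by positivity, ?_⟩
    rw [inv_pow, Real.sq_sqrt h.le, inv_mul_cancel₀ h.ne']
  have hs : ∀ k : ℤ, ((-1 : ℝ) ^ k) ^ 2 = 1 := fun k => by
    rw [← zpow_natCast, ← zpow_mul, mul_comm, zpow_mul]; simp
  have hs1 : ∀ k : ℤ, (-1 : ℝ) ^ (k + 1) = -(-1) ^ k := fun k => by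
    rw [zpow_add_one₀ (by norm_num)]; ring
  -- The alternating sign in the second field produces `B (k + 1) = -mirror _ (B k)` and leaves the
  -- transport of `N` without sign.
  have hframe : ∀ k ∈ J, IsParallelFrame I (x k) (fun u => c • n k u + (c * m) • b k u)
      (fun u => ((-1) ^ k * -(c * m)) • n k u + ((-1) ^ k * c) • b k u) := by
    intro k hk
    have h := hf k hk
    refine ⟨h.left.smul_add_smul h.right _ _, h.left.smul_add_smul h.right _ _,
      fun u hu => ?_, fun u hu => ?_, fun u hu => ?_⟩ <;>
      have h1 := h.norm_left u hu <;> have h2 := h.norm_right u hu <;>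
      have h3 := h.inner_eq_zero u hu <;>
      have h4 := (real_inner_comm _ _).trans h3
    · rw [← sq_eq_sq₀ (norm_nonneg _) zero_le_one, ← real_inner_self_eq_norm_sq]
      simp only [inner_add_left, inner_add_right, inner_smul_left, inner_smul_right,
        real_inner_self_eq_norm_sq, h1, h2, h3, h4, conj_trivial]
      linear_combination hc
    · rw [← sq_eq_sq₀ (norm_nonneg _) zero_le_one, ← real_inner_self_eq_norm_sq]
      simp only [inner_add_left, inner_add_right, inner_smul_left, inner_smul_right,
        real_inner_self_eq_norm_sq, h1, h2, h3, h4, conj_trivial]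
      linear_combination hc + c ^ 2 * (1 + m ^ 2) * hs k
    · simp only [inner_add_left, inner_add_right, inner_smul_left, inner_smul_right,
        real_inner_self_eq_norm_sq, h1, h2, h3, h4, conj_trivial]
      ring
  refine ⟨_, _, hframe, fun k u => ?_, fun k u => ?_, fun k hk hk1 u hu e he => ?_⟩
  · rw [hn, hb, mirror_add, mirror_smul, mirror_smul]
  · rw [hn, hb, mirror_add, mirror_smul, mirror_smul, hs1]
    module
  -- A chord parallel to `B` would be orthogonal to both the curve and `N`, which the choice of `m`
  -- excludes.
  · refine hm k hk hk1 u hu ?_ ?_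
    · rw [he, inner_smul_left, (hframe k hk).right.orthogonal u hu, mul_zero]
    · have h1 := (hframe k hk).inner_eq_zero u hu
      have h2 : n k u + m • b k u = c⁻¹ • (c • n k u + (c * m) • b k u) := by
        rw [smul_add, smul_smul, smul_smul, ← mul_assoc, inv_mul_cancel₀ hc0, one_smul, one_mul]
      rw [h2, he, inner_smul_left, inner_smul_right, real_inner_comm, h1, mul_zero, mul_zero]

end IsSemiDiscreteCurvatureLineNet

/-! ### Assembling the surface -/

theorem injective_partialsMap {a b : E3} (ha : a ≠ 0) (hb : b ≠ 0) (hab : inner ℝ a b = 0) :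
    Function.Injective (partialsMap a b) := by
  refine injective_of_inner (n := a) (c := ‖a‖ ^ 2) (by simpa using ha) (fun w => ?_) (by simpa)
  rw [partialsMap_apply, inner_add_right, inner_smul_right, inner_smul_right, hab,
    real_inner_self_eq_norm_sq, mul_zero, add_zero]

theorem isC1SurfaceWithNormal_const (I : Set ℝ) :
    IsC1SurfaceWithNormal I (fun _ => 0) (fun _ => EuclideanSpace.single 0 1) :=
  ⟨contDiffOn_const, continuousOn_const, fun _ _ => by simp, fun _ _ _ => by simp⟩

theorem mainTheorem9 (I : Set ℝ) (hI : IsOpen I) (hI' : I.OrdConnected)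
    (J : Set ℤ) (hJ : J.OrdConnected) (x : ℤ → ℝ → E3)
    (hx : IsSemiDiscreteCurvatureLineNet I J x) :
    ∃ f N : ℝ × ℝ → E3,
      IsC1SurfaceWithNormal I f N ∧
      -- the curves of the net are curvature lines of the surface, which is immersed along them
      (∀ k ∈ J, ∀ u ∈ I,
        f (u, (k : ℝ)) = x k u ∧
        Function.Injective (fderiv ℝ f (u, (k : ℝ))) ∧
        ∃ ρ : ℝ, HasDerivAt (fun t => N (t, (k : ℝ))) (ρ • deriv (x k) u) u) ∧
      -- the strip between two subsequent curves is a channel surface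
      (∀ k ∈ J, k + 1 ∈ J →
        IsChannelSurface I (Set.Icc (k : ℝ) ((k : ℝ) + 1)) f N ∧
        ∀ u ∈ I, {v ∈ Set.Icc (k : ℝ) ((k : ℝ) + 1) |
          ¬ Function.Injective (fderiv ℝ f (u, v))}.Finite) := by
  rcases J.eq_empty_or_nonempty with rfl | hne
  · exact ⟨_, _, isC1SurfaceWithNormal_const I, fun k hk => absurd hk (Set.notMem_empty k),
      fun k hk => absurd hk (Set.notMem_empty k)⟩
  obtain ⟨N, B, hf, hN, hB, hdB⟩ := hx.exists_generic_isParallelFrame hI hI' hJ hne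
  obtain ⟨c, hcJ, hc, hc1⟩ := exists_int_retraction hJ hne
  have hxB : ∀ k ∈ J, ∀ u ∈ I, inner ℝ (deriv (x k) u) (B k u) = 0 := fun k hk u hu =>
    (real_inner_comm _ _).trans ((hf k hk).right.orthogonal u hu)
  have hs : ∀ {k}, k ∈ J → k + 1 ∈ J → IsStripData I (x k) (x (k + 1)) (N k) (B k) :=
    fun {k} hk hk1 => ⟨hx.isSmoothRibaucourPair hk hk1, (hf k hk).left,
      (hf k hk).right.contDiffOn, (hf k hk).norm_left, (hf k hk).norm_right,
      (hf k hk).inner_eq_zero, hxB k hk, hdB k hk hk1⟩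
  classical
  let g : ℤ → ℝ × ℝ → E3 := fun k => if k ∈ J ∧ k + 1 ∈ J then strip (x k) (x (k + 1)) (B k) k
    else ruledStrip (x (c k)) (B (c k)) (c k)
  let M : ℤ → ℝ × ℝ → E3 := fun k => if k ∈ J ∧ k + 1 ∈ J then
    stripNormal (x k) (x (k + 1)) (N k) (B k) k else fun p => N (c k) p.1
  have hgM : ∀ k, IsC1Strip I k (g k) (M k) := by
    intro k
    by_cases h : k ∈ J ∧ k + 1 ∈ J
    · simp only [g, M, if_pos h]
      exact (hs h.1 h.2).isC1Strip k hI
    · have hk := hcJ k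
      simp only [g, M, if_neg h]
      exact isC1Strip_ruledStrip hI _ _ (hx.smooth _ hk) (hf _ hk).left
        (hf _ hk).right.contDiffOn (hf _ hk).norm_left (hf _ hk).inner_eq_zero (hxB _ hk)
  have hruled : ∀ k ∈ J, ∀ u ∈ I, HasFDerivAt (ruledStrip (x k) (B k) k)
      (partialsMap (deriv (x k) u) (B k u)) (u, (k : ℝ)) := by
    intro k hk u hu
    simpa using hasFDerivAt_ruledStrip hI k (hx.smooth k hk) (hf k hk).right.contDiffOn hu k
  -- Strips from either side of the curve `x k` have the same first-order data there: partial
  -- derivatives `x k'` and `B k`, and normal `N k`.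
  have hleft : ∀ k ∈ J, ∀ u ∈ I, g k (u, k) = x k u ∧ M k (u, k) = N k u ∧
      HasFDerivAt (g k) (partialsMap (deriv (x k) u) (B k u)) (u, (k : ℝ)) := by
    intro k hk u hu
    by_cases h : k ∈ J ∧ k + 1 ∈ J
    · simp only [g, M, if_pos h]
      exact ⟨IsStripData.strip_left k u, IsStripData.stripNormal_left k u,
        (hs h.1 h.2).hasFDerivAt_strip_left k hI hu⟩
    · simp only [g, M, if_neg h, hc k hk]
      exact ⟨by simp [ruledStrip], trivial, hruled k hk u hu⟩
  have hright : ∀ k, k + 1 ∈ J → ∀ u ∈ I, g k (u, k + 1) = x (k + 1) u ∧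
      M k (u, k + 1) = N (k + 1) u ∧
      HasFDerivAt (g k) (partialsMap (deriv (x (k + 1)) u) (B (k + 1) u)) (u, (k + 1 : ℝ)) := by
    intro k hk u hu
    by_cases h : k ∈ J ∧ k + 1 ∈ J
    · simp only [g, M, if_pos h, hN, hB]
      exact ⟨(hs h.1 h.2).strip_right k hu, (hs h.1 h.2).stripNormal_right k hu,
        (hs h.1 h.2).hasFDerivAt_strip_right k hI hu⟩
    · simp only [g, M, if_neg h, hc1 k h, hc _ hk]
      have := hruled _ hk u hu
      push_cast at this
      exact ⟨by simp [ruledStrip], trivial, this⟩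
  -- If `k + 1 ∉ J`, both neighbouring strips are parts of one ruled surface.
  have heq : ∀ k, k + 1 ∉ J → g k = g (k + 1) ∧ M k = M (k + 1) := by
    intro k hk
    have h1 : ¬ (k ∈ J ∧ k + 1 ∈ J) := fun h => hk h.2
    have h2 : ¬ (k + 1 ∈ J ∧ k + 1 + 1 ∈ J) := fun h => hk h.1
    simp only [g, M, if_neg h1, if_neg h2, hc1 k h1, and_self]
  have hmatch : ∀ k : ℤ, ∀ u ∈ I, g k (u, k + 1) = g (k + 1) (u, k + 1) ∧
      M k (u, k + 1) = M (k + 1) (u, k + 1) ∧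
      fderiv ℝ (g k) (u, k + 1) = fderiv ℝ (g (k + 1)) (u, k + 1) := by
    intro k u hu
    by_cases hk : k + 1 ∈ J
    · obtain ⟨h1, h2, h3⟩ := hright k hk u hu
      obtain ⟨h4, h5, h6⟩ := hleft (k + 1) hk u hu
      push_cast at h4 h5 h6
      exact ⟨h1.trans h4.symm, h2.trans h5.symm, h3.fderiv.trans h6.fderiv.symm⟩
    · rw [(heq k hk).1, (heq k hk).2]
      exact ⟨rfl, rfl, rfl⟩
  have hg := fun k u hu => (hmatch k u hu).1
  have hM := fun k u hu => (hmatch k u hu).2.1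
  have hg' := fun k u hu => (hmatch k u hu).2.2
  have hfd : ∀ (k : ℤ), ∀ p ∈ I ×ˢ Set.Icc (k : ℝ) (k + 1),
      fderiv ℝ (glue g) p = fderiv ℝ (g k) p := fun k p hp =>
    (hasFDerivAt_glue hI hg hg' (fun k => (hgM k).differentiableAt) hp.1).fderiv.trans
      (glue_eq hg' hp)
  have hmem : ∀ (k : ℤ), ∀ u ∈ I, (u, (k : ℝ)) ∈ I ×ˢ Set.Icc (k : ℝ) (k + 1) :=
    fun k u hu => ⟨hu, by simp⟩
  refine ⟨glue g, glue M, isC1SurfaceWithNormal_glue hI hgM hg hg' hM, fun k hk u hu => ?_,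
    fun k hk hk1 => ⟨?_, fun u hu => ?_⟩⟩
  · obtain ⟨h1, -, h3⟩ := hleft k hk u hu
    refine ⟨(glue_eq hg (hmem k u hu)).trans h1, ?_, ?_⟩
    · rw [hfd k _ (hmem k u hu), h3.fderiv]
      refine injective_partialsMap (hx.regular k hk u hu) ?_ (hxB k hk u hu)
      intro h0
      simpa [h0] using (hf k hk).norm_right u hu
    -- Along `x k` the glued normal is the parallel field `N k`, so the curve is a curvature line.
    · obtain ⟨ρ, hρ⟩ := (hf k hk).left.hasDerivAt u hu
      exact ⟨ρ, hρ.congr_of_eventuallyEq (Filter.eventuallyEq_of_mem (hI.mem_nhds hu)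
        fun t ht => (glue_eq hM (hmem k t ht)).trans (hleft k hk t ht).2.1)⟩
  · refine (hs hk hk1).isChannelSurface k hI (fun p hp => ?_) (fun p hp => ?_)
    · rw [glue_eq hg hp]
      simp only [g, if_pos (And.intro hk hk1)]
    · rw [glue_eq hM hp]
      simp only [M, if_pos (And.intro hk hk1)]
  · refine ((hs hk hk1).finite_not_injective k hI hu).subset fun v hv => ⟨hv.1, ?_⟩
    have := hv.2
    rw [hfd k _ ⟨hu, hv.1⟩] at this
    simpa only [g, if_pos (And.intro hk hk1)] using this
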